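/- Fix a notion of smallness for sets; $\mathbf{Set}$ is the category of small sets, and categories are locally small but possibly large. "Lex" means preserving finite limits. For a category $\mathcal C$, a presheaf $\mathcal C^{\mathrm{op}}\to\mathbf{Set}$ is small if it is the left Kan extension of its restriction to some small full subcategory of $\mathcal C$; $\mathcal P\mathcal C$ is the category of small presheaves and $Y\colon\mathcal C\to\mathcal P\mathcal C$ the Yoneda embedding. A class of lex-weights $\Phi$ is any collection of functors $\phi\colon\mathcal K^{\mathrm{op}}\to\mathbf{Set}$ with $\mathcal K$ small and finitely complete (no limit preservation by $\phi$ is required); $\Phi[\mathcal K]$ denotes the members with domain $\mathcal K^{\mathrm{op}}$. A $\Phi$-lex-colimit in a finitely complete category is a weighted colimit $\phi\star D$ with $\phi\in\Phi[\mathcal K]$ and $D$ a lex functor out of $\mathcal K$. A finitely complete category $\mathcal C$ is $\Phi$-lex-cocomplete if $\phi\star D$ exists for all $\phi\in\Phi[\mathcal K]$ and all lex $D\colon\mathcal K\to\mathcal C$. For finitely complete $\mathcal C$, let $\Phi_l\mathcal C$ be the smallest full replete subcategory of $\mathcal P\mathcal C$ that contains the representables and is closed under finite limits and $\Phi$-lex-colimits,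 and let $W\colon\mathcal C\to\Phi_l\mathcal C$ be the restricted Yoneda embedding. The saturation $\Phi^*$ is the class of all presheaves that lie in $\Phi_l\mathcal K$ for some small finitely complete $\mathcal K$. The finitely complete $\mathcal C$ is $\Phi$-exact if it is $\Phi^*$-lex-cocomplete and $W$ admits a left adjoint that is lex. A morphism $f\colon\phi\to\psi$ of $\mathcal P\mathcal C$ is final if every map from $\phi$ to a representable extends uniquely along $f$, and stably final if every pullback of $f$ in $\mathcal P\mathcal C$ is final. It is postulated if both its image $\mathrm{im}(f)\rightarrowtail\psi$ and its diagonal $\phi\rightarrowtail\phi\times_\psi\phi$ are stably final. A $\Phi$-lex-colimit morphism in $\mathcal P\mathcal C$ is a final morphism of the form $\mathrm{Lan}_{D^{\mathrm{op}}}(\phi)\to Y(\phi\star D)$ with $\phi\in\Phi[\mathcal K]$ and $D\colon\mathcal K\to\mathcal C$ lex. Theorem. Let $\Phi$ be a class of lex-weights and let $\mathcal C$ be a finitely complete and $\Phi$-lex-cocomplete category. Then $\mathcal C$ is $\Phi$-exact if and only if every $\Phi$-lex-colimit morphism in $\mathcal P\mathcal C$ is postulated. -/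

import Mathlib

open CategoryTheory CategoryTheory.Limits Opposite

universe v u v₁ u₁

namespace LexExact

/-! ### Small presheaves -/

section SmallPresheaves

/-- A presheaf on a (possibly large, locally small) category `C` is small when it is the
(pointwise) left Kan extension of its restriction to some small full subcategory of `C`; here, a
full subcategory is small when it has only a small set of isomorphism classes of objects. -/
def IsSmallPresheaf {C : Type u} [Category.{v} C] : ObjectProperty (Cᵒᵖ ⥤ Type v) := fun φ =>
  ∃ P : ObjectProperty C, ObjectProperty.EssentiallySmall.{v} P ∧
    Nonempty (Functor.LeftExtension.mk (L := P.ι.op) φ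
      (𝟙 (P.ι.op ⋙ φ))).IsPointwiseLeftKanExtension

variable (C : Type u) [Category.{v} C]

/-- The category `𝒫 C` of small presheaves on `C`, a full subcategory of all presheaves. -/
abbrev SmallPsh : Type (max u (v + 1)) :=
  (IsSmallPresheaf (C := C)).FullSubcategory

variable {C}

theorem isSmallPresheaf_yoneda (X : C) : IsSmallPresheaf (yoneda.obj X) := by
  refine ⟨ObjectProperty.ofObj (fun _ : PUnit.{v + 1} => X), inferInstance, ⟨fun A => ?_⟩⟩
  have hX : ObjectProperty.ofObj (fun _ : PUnit.{v + 1} => X) X :=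
    ObjectProperty.ofObj_apply _ PUnit.unit
  let X' : (ObjectProperty.ofObj (fun _ : PUnit.{v + 1} => X)).FullSubcategory := ⟨X, hX⟩
  exact
    { desc := fun s => TypeCat.ofHom fun g =>
        s.ι.app (CostructuredArrow.mk (Y := op X') (S := ObjectProperty.ι _ |>.op)
          (Quiver.Hom.op (X := A.unop) (Y := X) g)) (𝟙 X)
      fac := fun s j => by
        ext h
        let j' : CostructuredArrow (ObjectProperty.ofObj (fun _ : PUnit.{v + 1} => X)).ι.op A :=
          CostructuredArrow.mk (Y := op X') (S := ObjectProperty.ι _ |>.op)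
            (Quiver.Hom.op (X := A.unop) (Y := X) (j.hom.unop ≫ h))
        let k : j' ⟶ j := CostructuredArrow.homMk
          (Quiver.Hom.op (ObjectProperty.homMk h : j.left.unop ⟶ X')) rfl
        have hk := ConcreteCategory.congr_hom (s.w k) (𝟙 X)
        have e : (yoneda.obj X).map h.op (𝟙 X) = h := Category.comp_id h
        exact hk.symm.trans (congrArg (s.ι.app j) e)
      uniq := fun s m hm => by
        ext g
        have h := ConcreteCategory.congr_hom
          (hm (CostructuredArrow.mk (Y := op X') (S := ObjectProperty.ι _ |>.op)
            (Quiver.Hom.op (X := A.unop) (Y := X) g))) (𝟙 X)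
        have e : (yoneda.obj X).map (Quiver.Hom.op (X := A.unop) (Y := X) g) (𝟙 X) = g :=
          Category.comp_id (X := A.unop) (Y := X) g
        exact (congrArg m e).symm.trans h }

/-- The restricted Yoneda embedding `Y : C ⥤ 𝒫 C`. -/
def smallYoneda (C : Type u) [Category.{v} C] : C ⥤ SmallPsh C :=
  ObjectProperty.lift _ yoneda isSmallPresheaf_yoneda

end SmallPresheaves

/-! ### Weighted colimits and classes of lex-weights -/

section Weights

variable {K : Type v} [SmallCategory K] {A : Type u₁} [Category.{v₁} A]

/-- A cocone with vertex `c` under `D : K ⥤ A`, weighted by `φ`: a natural transformation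
`φ ⟶ A(D -, c)`, written elementwise so that no relation is needed between the universe of the
values of `φ` and that of the morphisms of `A`. -/
structure WeightedCocone (φ : Kᵒᵖ ⥤ Type v) (D : K ⥤ A) (c : A) where
  /-- The components of the transformation. -/
  app : ∀ k : K, φ.obj (op k) → (D.obj k ⟶ c)
  naturality : ∀ ⦃k k' : K⦄ (g : k ⟶ k') (x : φ.obj (op k')),
    app k (φ.map g.op x) = D.map g ≫ app k' x

/-- The weighted cocone `γ` exhibits its vertex `c` as the weighted colimit `φ ⋆ D`: composition
with `γ` is a bijection from morphisms `c ⟶ X` to weighted cocones with vertex `X`. -/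
def WeightedCocone.IsColimit {φ : Kᵒᵖ ⥤ Type v} {D : K ⥤ A} {c : A}
    (γ : WeightedCocone φ D c) : Prop :=
  ∀ ⦃X : A⦄ (θ : WeightedCocone φ D X),
    ∃! h : c ⟶ X, ∀ (k : K) (x : φ.obj (op k)), γ.app k x ≫ h = θ.app k x

end Weights

/-- A class of lex-weights: a collection of presheaves `φ : Kᵒᵖ ⥤ Type v` on small finitely
complete categories `K`. The presheaves are not required to preserve limits. `Φ K` is the
collection of members of `Φ` with domain `Kᵒᵖ`. -/
abbrev LexWeightClass : Type (v + 1) :=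
  ∀ (K : Type v) [SmallCategory K] [HasFiniteLimits K], Set (Kᵒᵖ ⥤ Type v)

/-- `C`, assumed finitely complete, is `Φ`-lex-cocomplete when `φ ⋆ D` exists for every `φ` in `Φ`
and every left exact `D : K ⥤ C`. -/
def IsLexCocomplete (Φ : LexWeightClass.{v}) (C : Type u) [Category.{v} C]
    [HasFiniteLimits C] : Prop :=
  ∀ (K : Type v) [SmallCategory K] [HasFiniteLimits K], ∀ φ ∈ Φ K,
    ∀ (D : K ⥤ C) [PreservesFiniteLimits D],
      ∃ (c : C) (γ : WeightedCocone φ D c), γ.IsColimit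

/-! ### `Φ`-exact categories -/

section Exact

/-- The smallest replete class of objects of `𝒫 C` that contains the representables and is closed
in `𝒫 C` under finite limits and under `Φ`-lex-colimits. (Repleteness is the closure under limits
indexed by the one-point category.) -/
inductive LexClosure (Φ : LexWeightClass.{v}) {C : Type u} [Category.{v} C] :
    ObjectProperty (SmallPsh C)
  | representable (X : C) : LexClosure Φ ((smallYoneda C).obj X)
  | finiteLimit (J : Type) [SmallCategory J] [FinCategory J] (F : J ⥤ SmallPsh C)
      (hF : ∀ j, LexClosure Φ (F.obj j)) (t : Cone F) (ht : IsLimit t) : LexClosure Φ t.pt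
  | lexColimit (K : Type v) [SmallCategory K] [HasFiniteLimits K] (φ : Kᵒᵖ ⥤ Type v)
      (hφ : φ ∈ Φ K) (D : K ⥤ SmallPsh C) [PreservesFiniteLimits D]
      (hD : ∀ k, LexClosure Φ (D.obj k)) (ψ : SmallPsh C) (γ : WeightedCocone φ D ψ)
      (hγ : γ.IsColimit) : LexClosure Φ ψ

/-- The category `Φₗ C`: the closure of the representables in `𝒫 C` under finite limits and
`Φ`-lex-colimits. -/
abbrev LexCompletion (Φ : LexWeightClass.{v}) (C : Type u) [Category.{v} C] :
    Type (max u (v + 1)) :=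
  (LexClosure Φ (C := C)).FullSubcategory

/-- The restricted Yoneda embedding `W : C ⥤ Φₗ C`. -/
def lexCompletionUnit (Φ : LexWeightClass.{v}) (C : Type u) [Category.{v} C] :
    C ⥤ LexCompletion Φ C :=
  ObjectProperty.lift _ (smallYoneda C) LexClosure.representable

/-- The saturation `Φ*` of `Φ`: all presheaves lying in `Φₗ K` for some small finitely
complete `K`. -/
def saturation (Φ : LexWeightClass.{v}) : LexWeightClass.{v} :=
  fun K _ _ => {φ | ∃ h : IsSmallPresheaf φ, LexClosure Φ (C := K) ⟨φ, h⟩}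

/-- `C`, assumed finitely complete, is `Φ`-exact when it is `Φ*`-lex-cocomplete and
`W : C ⥤ Φₗ C` has a left exact left adjoint. -/
def IsExact (Φ : LexWeightClass.{v}) (C : Type u) [Category.{v} C] [HasFiniteLimits C] : Prop :=
  IsLexCocomplete (saturation Φ) C ∧
    ∃ L : LexCompletion Φ C ⥤ C,
      Nonempty (L ⊣ lexCompletionUnit Φ C) ∧ PreservesFiniteLimits L

end Exact

/-! ### Postulated morphisms -/

section Postulated

variable {C : Type u} [Category.{v} C]

/-- A morphism `f : φ ⟶ ψ` of `𝒫 C` is final when it is orthogonal to every representable. -/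
def IsFinalMor {φ ψ : SmallPsh C} (f : φ ⟶ ψ) : Prop :=
  ∀ (X : C) (g : φ ⟶ (smallYoneda C).obj X), ∃! h : ψ ⟶ (smallYoneda C).obj X, f ≫ h = g

/-- A morphism of `𝒫 C` is stably final when all of its pullbacks in `𝒫 C` are final. -/
def IsStablyFinal {φ ψ : SmallPsh C} (f : φ ⟶ ψ) : Prop :=
  ∀ ⦃φ' ψ' : SmallPsh C⦄ (g' : φ' ⟶ φ) (f' : φ' ⟶ ψ') (g : ψ' ⟶ ψ),
    IsPullback g' f' f g → IsFinalMor f'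

/-- A morphism `f : φ ⟶ ψ` of `𝒫 C` is postulated when its image `im f ⟶ ψ` and its diagonal
`φ ⟶ φ ×_ψ φ` are both stably final. -/
def IsPostulated {φ ψ : SmallPsh C} (f : φ ⟶ ψ) : Prop :=
  (∃ F : MonoFactorisation f, Nonempty (IsImage F) ∧ IsStablyFinal F.m) ∧
    ∃ (κ : SmallPsh C) (p q : κ ⟶ φ) (h : IsPullback p q f f),
      IsStablyFinal (h.lift (𝟙 φ) (𝟙 φ) rfl)

/-- A `Φ`-lex-colimit morphism: a final morphism `f` of `𝒫 C` of the form
`Lan_{Dᵒᵖ} φ ⟶ Y (φ ⋆ D)` for some `φ` in `Φ` and some left exact `D : K ⥤ C`. Here `α` exhibits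
`ψ` as the left Kan extension and `γ` exhibits `c` as the weighted colimit. -/
def IsLexColimitMor (Φ : LexWeightClass.{v}) {ψ : SmallPsh C} {c : C}
    (f : ψ ⟶ (smallYoneda C).obj c) : Prop :=
  ∃ (K : Type v) (_ : SmallCategory K) (_ : HasFiniteLimits K) (φ : Kᵒᵖ ⥤ Type v)
    (D : K ⥤ C) (α : φ ⟶ D.op ⋙ ψ.obj) (γ : WeightedCocone φ D c),
    φ ∈ Φ K ∧ PreservesFiniteLimits D ∧
      Nonempty (Functor.LeftExtension.mk (L := D.op) ψ.obj α).IsPointwiseLeftKanExtension ∧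
      γ.IsColimit ∧ IsFinalMor f

/-- `Φ`-lex-colimits are postulated in `C`: every `Φ`-lex-colimit morphism of `𝒫 C` is
postulated. -/
def LexColimitsPostulated (Φ : LexWeightClass.{v}) (C : Type u) [Category.{v} C] : Prop :=
  ∀ ⦃ψ : SmallPsh C⦄ ⦃c : C⦄ (f : ψ ⟶ (smallYoneda C).obj c),
    IsLexColimitMor Φ f → IsPostulated f

end Postulated

end LexExact

/-!
The proof rests on one characterization: a morphism of `𝒫 C` is postulated exactly when it is
bidense, that is, locally bijective for the canonical topology on `C`
(`isPostulated_iff_isBidense`). Indeed, if the pullback of a morphism along an element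
`Y X ⟶ ψ` is final, then the representables satisfy the sheaf condition for the sieve on which that
element lifts (`isSheafFor_imageSieve`); asking this stably makes the sieve a covering of the
canonical topology. Conversely bidense morphisms are stable under pullback and orthogonal to
sheaves, in particular to the representables.

Suppose that `C` is `Φ`-exact, with lex reflector `L`. A left adjoint of `W` inverts exactly the
final morphisms (`isIso_map_iff_isFinalMor`), and a lex one also inverts their pullbacks and
diagonals. The domain of a `Φ`-lex-colimit morphism lies in `Φₗ C`, so that such a morphism is
inverted by `L`, hence bidense (`isBidense_of_isIso_map`).

Suppose now that `Φ`-lex-colimits are postulated, and consider the small presheaves that admit a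
bidense morphism to a representable. Such a morphism is a reflection into `C`. Bidense morphisms are
closed under finite limits and under weighted colimits (`IsBidense.of_isLimit`,
`IsBidense.of_isPointwise`), so that the reflector is lex, and the class of these presheaves is
closed under finite limits and, since `Φ`-lex-colimit morphisms are bidense, under
`Φ`-lex-colimits (`hasBidenseReflection_of_lexColimit`). It therefore contains `Φₗ C`, which gives
the lex left adjoint of `W`. For `φ` in `Φₗ K` and `D : K ⥤ C` lex, left Kan extension along `D` is
a lex left adjoint, so it takes `φ` into `Φₗ C` (`lexClosure_smallLan`); the
reflection of `Lan_{Dᵒᵖ} φ` is `φ ⋆ D`.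

Since `C` may be large, all presheaves involved have to be shown small. This is done elementwise: a
presheaf is small when, for some essentially small full subcategory closed under finite limits, its
elements are restrictions of elements over that subcategory and all coincidences between such
restrictions are visible there (`SmallOn`).
-/

universe w

namespace LexExact

/-! ### Small presheaves, elementwise -/

/-- Elements with the same image in a colimit of types are related by every equivalence relation
that is compatible with the diagram. There is no universe restriction on the shape. -/
theorem rel_of_isColimit {J : Type u₁} [Category.{v₁} J] {F : J ⥤ Type w} {s : Cocone F}
    (hs : IsColimit s) (R : (Σ j, F.obj j) → (Σ j, F.obj j) → Prop) (hR : Equivalence R)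
    (hmap : ∀ ⦃j j' : J⦄ (g : j ⟶ j') (x : F.obj j), R ⟨j, x⟩ ⟨j', F.map g x⟩)
    {j j' : J} {x : F.obj j} {x' : F.obj j'} (h : s.ι.app j x = s.ι.app j' x') :
    R ⟨j, x⟩ ⟨j', x'⟩ := by
  -- The class of `⟨j, x⟩` is a cocone with values in propositions.
  let t : Cocone F :=
    { pt := ULift.{w} Prop
      ι :=
        { app := fun i => TypeCat.ofHom fun y => ⟨R ⟨j, x⟩ ⟨i, y⟩⟩
          naturality := fun i i' g => by
            ext y
            exact congrArg ULift.up (propext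
              ⟨fun h => hR.trans h (hR.symm (hmap g y)), fun h => hR.trans h (hmap g y)⟩) } }
  have h₁ := ConcreteCategory.congr_hom (hs.fac t j) x
  have h₂ := ConcreteCategory.congr_hom (hs.fac t j') x'
  have h₃ : (t.ι.app j x : ULift.{w} Prop) = t.ι.app j' x' := by
    rw [← h₁, ← h₂]
    exact congrArg (hs.desc t) h
  have h₄ : R ⟨j, x⟩ ⟨j, x⟩ = R ⟨j, x⟩ ⟨j', x'⟩ := congrArg ULift.down h₃
  exact h₄ ▸ hR.refl _

section

variable {C : Type u} [Category.{v} C]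

theorem map_op_map_op (φ : Cᵒᵖ ⥤ Type v) {X Y Z : C} (f : X ⟶ Y) (g : Y ⟶ Z)
    (x : φ.obj (op Z)) : φ.map f.op (φ.map g.op x) = φ.map (f ≫ g).op x := by
  rw [op_comp, Functor.map_comp_apply]

/-- Elementwise smallness of `φ` relative to a full subcategory `P`: all elements of `φ` are
restrictions of elements over objects of `P`, and any coincidence between restrictions of such
elements is already visible over an object of `P`. -/
structure SmallOn (P : ObjectProperty C) (φ : Cᵒᵖ ⥤ Type v) : Prop where
  exists_factor : ∀ (X : C) (x : φ.obj (op X)),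
    ∃ (A : C) (_ : P A) (f : X ⟶ A) (y : φ.obj (op A)), φ.map f.op y = x
  exists_eq : ∀ ⦃X A A' : C⦄, P A → P A' → ∀ (f : X ⟶ A) (f' : X ⟶ A')
    (y : φ.obj (op A)) (y' : φ.obj (op A')), φ.map f.op y = φ.map f'.op y' →
    ∃ (B : C) (_ : P B) (h : X ⟶ B) (k : B ⟶ A) (k' : B ⟶ A'),
      h ≫ k = f ∧ h ≫ k' = f' ∧ φ.map k.op y = φ.map k'.op y'

/-- A small full subcategory closed under finite limits. -/
structure IsSmallLex [HasFiniteLimits C] (P : ObjectProperty C) : Prop where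
  small : ObjectProperty.EssentiallySmall.{v} P
  terminal : P (⊤_ C)
  pullback : ∀ ⦃A B D : C⦄ (f : A ⟶ D) (g : B ⟶ D), P A → P B → P D → P (pullback f g)

variable [HasFiniteLimits C]

theorem IsSmallLex.exists_prod {P : ObjectProperty C} (hP : IsSmallLex P) {A B : C}
    (hA : P A) (hB : P B) : ∃ (D : C) (_ : P D) (p : D ⟶ A) (q : D ⟶ B),
      ∀ ⦃X : C⦄ (f : X ⟶ A) (g : X ⟶ B), ∃! h : X ⟶ D, h ≫ p = f ∧ h ≫ q = g :=
  ⟨_, hP.pullback (terminal.from A) (terminal.from B) hA hB hP.terminal, pullback.fst _ _,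
    pullback.snd _ _, fun _ f g => ⟨pullback.lift f g (Subsingleton.elim _ _),
      ⟨pullback.lift_fst _ _ _, pullback.lift_snd _ _ _⟩,
      fun _ h => pullback.hom_ext (h.1.trans (pullback.lift_fst _ _ _).symm)
        (h.2.trans (pullback.lift_snd _ _ _).symm)⟩⟩

/-- An essentially small full subcategory generates an essentially small one under finite limits. -/
theorem exists_isSmallLex_ge (P : ObjectProperty C) (hP : ObjectProperty.EssentiallySmall.{v} P) :
    ∃ Q : ObjectProperty C, IsSmallLex Q ∧ P ≤ Q := by
  let P' : ObjectProperty C := P ⊔ ObjectProperty.ofObj (fun _ : PUnit.{v + 1} => ⊤_ C)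
  let Q : ObjectProperty C := P'.limitsClosure (fun _ : PUnit.{1} => WalkingCospan)
  have hP' : P' ≤ Q := P'.le_limitsClosure _
  refine ⟨Q, ⟨inferInstance, ?_, ?_⟩, le_trans le_sup_left hP'⟩
  · exact hP' _ (Or.inr (ObjectProperty.ofObj_apply _ PUnit.unit))
  · intro A B D f g hA hB hD
    have : Q.IsClosedUnderLimitsOfShape WalkingCospan :=
      inferInstanceAs ((P'.limitsClosure (fun _ : PUnit.{1} => WalkingCospan)
        ).IsClosedUnderLimitsOfShape ((fun _ : PUnit.{1} => WalkingCospan) PUnit.unit))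
    refine ObjectProperty.prop_limit _ _ fun j => ?_
    rcases j with _ | _ | _
    exacts [hD, hA, hB]

/-- It is enough to test coincidences between elements over the generating objects `P`, when a
larger subcategory `Q` with finite limits may be used to witness them. -/
theorem SmallOn.of_le {P Q : ObjectProperty C} (hQ : IsSmallLex Q) (hPQ : P ≤ Q)
    {φ : Cᵒᵖ ⥤ Type v}
    (h₁ : ∀ (X : C) (x : φ.obj (op X)),
      ∃ (A : C) (_ : P A) (f : X ⟶ A) (y : φ.obj (op A)), φ.map f.op y = x)
    (h₂ : ∀ ⦃X A A' : C⦄, P A → P A' → ∀ (f : X ⟶ A) (f' : X ⟶ A')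
      (y : φ.obj (op A)) (y' : φ.obj (op A')), φ.map f.op y = φ.map f'.op y' →
      ∃ (B : C) (_ : Q B) (h : X ⟶ B) (k : B ⟶ A) (k' : B ⟶ A'),
        h ≫ k = f ∧ h ≫ k' = f' ∧ φ.map k.op y = φ.map k'.op y') :
    SmallOn Q φ where
  exists_factor X x := by
    obtain ⟨A, hA, f, y, h⟩ := h₁ X x
    exact ⟨A, hPQ _ hA, f, y, h⟩
  exists_eq X A A' hA hA' f f' y y' h := by
    obtain ⟨A₀, hA₀, g, z, rfl⟩ := h₁ A y
    obtain ⟨A₀', hA₀', g', z', rfl⟩ := h₁ A' y'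
    obtain ⟨B, hB, e, k, k', hk, hk', hz⟩ := h₂ hA₀ hA₀' (f ≫ g) (f' ≫ g') z z' (by simpa using h)
    -- The object `B ×_{A₀ × A₀'} (A × A')`, as an iterated pullback.
    refine ⟨pullback (pullback.fst k g) (pullback.fst k' g'),
      hQ.pullback _ _ (hQ.pullback _ _ hB hA (hPQ _ hA₀)) (hQ.pullback _ _ hB hA' (hPQ _ hA₀')) hB,
      pullback.lift (pullback.lift e f hk) (pullback.lift e f' hk')
        (by rw [pullback.lift_fst, pullback.lift_fst]),
      pullback.fst _ _ ≫ pullback.snd _ _, pullback.snd _ _ ≫ pullback.snd _ _,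
      by rw [pullback.lift_fst_assoc, pullback.lift_snd],
      by rw [pullback.lift_snd_assoc, pullback.lift_snd], ?_⟩
    rw [map_op_map_op, map_op_map_op, Category.assoc, Category.assoc, ← pullback.condition,
      ← pullback.condition, pullback.condition_assoc]
    simpa only [map_op_map_op, Category.assoc] using congrArg
      (φ.map (pullback.snd (pullback.fst k g) (pullback.fst k' g') ≫ pullback.fst k' g').op) hz

theorem SmallOn.mono {P Q : ObjectProperty C} (hQ : IsSmallLex Q) (hPQ : P ≤ Q)
    {φ : Cᵒᵖ ⥤ Type v} (h : SmallOn P φ) : SmallOn Q φ :=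
  .of_le hQ hPQ h.exists_factor fun _ _ _ hA hA' f f' y y' hy => by
    obtain ⟨B, hB, r⟩ := h.exists_eq hA hA' f f' y y' hy
    exact ⟨B, hPQ _ hB, r⟩

theorem SmallOn.isSmallPresheaf {P : ObjectProperty C} (hP : IsSmallLex P) {φ : Cᵒᵖ ⥤ Type v}
    (h : SmallOn P φ) : IsSmallPresheaf φ := by
  refine ⟨P, hP.small, ⟨fun X => ?_⟩⟩
  choose A hA f y hy using h.exists_factor X.unop
  let j (x : φ.obj X) : CostructuredArrow P.ι.op X :=
    CostructuredArrow.mk (Y := op (⟨A x, hA x⟩ : P.FullSubcategory)) (S := P.ι.op)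
      (Quiver.Hom.op (X := X.unop) (Y := A x) (f x))
  have key (s : Cocone (CostructuredArrow.proj P.ι.op X ⋙ P.ι.op ⋙ φ))
      (i i' : CostructuredArrow P.ι.op X) (z : φ.obj (op i.left.unop.obj))
      (z' : φ.obj (op i'.left.unop.obj))
      (hz : φ.map i.hom z = φ.map i'.hom z') : s.ι.app i z = s.ι.app i' z' := by
    obtain ⟨B, hB, e, k, k', hk, hk', hz⟩ := h.exists_eq i.left.unop.property
      i'.left.unop.property i.hom.unop i'.hom.unop z z' hz
    let b : CostructuredArrow P.ι.op X :=
      CostructuredArrow.mk (Y := op (⟨B, hB⟩ : P.FullSubcategory)) (S := P.ι.op)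
        (Quiver.Hom.op (X := X.unop) (Y := B) e)
    let a : i ⟶ b := CostructuredArrow.homMk
      (Quiver.Hom.op (ObjectProperty.homMk k : (⟨B, hB⟩ : P.FullSubcategory) ⟶ i.left.unop))
      (congrArg Quiver.Hom.op hk)
    let a' : i' ⟶ b := CostructuredArrow.homMk
      (Quiver.Hom.op (ObjectProperty.homMk k' : (⟨B, hB⟩ : P.FullSubcategory) ⟶ i'.left.unop))
      (congrArg Quiver.Hom.op hk')
    have h₁ := ConcreteCategory.congr_hom (s.w a) z
    have h₂ := ConcreteCategory.congr_hom (s.w a') z'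
    exact h₁.symm.trans ((congrArg (s.ι.app b) hz).trans h₂)
  exact
    { desc := fun s => TypeCat.ofHom fun x => s.ι.app (j x) (y x)
      fac := fun s i => by
        ext z
        refine key s _ _ _ _ ((hy _).trans ?_)
        exact congrArg (φ.map i.hom) rfl
      uniq := fun s m hm => by
        ext x
        have h₁ := ConcreteCategory.congr_hom (hm (j x)) (y x)
        refine Eq.trans ?_ h₁
        exact congrArg m (hy x).symm }

theorem IsSmallPresheaf.exists_smallOn {φ : Cᵒᵖ ⥤ Type v} (h : IsSmallPresheaf φ) :
    ∃ P : ObjectProperty C, IsSmallLex P ∧ SmallOn P φ := by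
  obtain ⟨P, hP, ⟨hφ⟩⟩ := h
  obtain ⟨Q, hQ, hPQ⟩ := exists_isSmallLex_ge P hP
  refine ⟨Q, hQ, .of_le hQ hPQ ?_ ?_⟩
  · intro X x
    obtain ⟨j, y, hy⟩ := Types.jointly_surjective_of_isColimit (hφ (op X)) x
    exact ⟨j.left.unop.obj, j.left.unop.property, j.hom.unop, y, hy⟩
  · intro X A A' hA hA' f f' y y' hy
    let R (t t' : Σ j, (CostructuredArrow.proj P.ι.op (op X) ⋙ P.ι.op ⋙ φ).obj j) : Prop :=
      ∃ (B : C) (_ : Q B) (h : X ⟶ B) (k : B ⟶ t.1.left.unop.obj) (k' : B ⟶ t'.1.left.unop.obj),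
        h ≫ k = t.1.hom.unop ∧ h ≫ k' = t'.1.hom.unop ∧
          φ.map k.op (show φ.obj (op t.1.left.unop.obj) from t.2) =
            φ.map k'.op (show φ.obj (op t'.1.left.unop.obj) from t'.2)
    have hR : Equivalence R :=
      { refl := fun t => ⟨_, hPQ _ t.1.left.unop.property, t.1.hom.unop, 𝟙 _, 𝟙 _,
          Category.comp_id _, Category.comp_id _, rfl⟩
        symm := fun ⟨B, hB, h, k, k', hk, hk', e⟩ => ⟨B, hB, h, k', k, hk', hk, e.symm⟩
        trans := by
          rintro t t' t'' ⟨B, hB, h, k, k', hk, hk', e⟩ ⟨B₁, hB₁, h₁, k₁, k₁', hk₁, hk₁', e₁⟩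
          refine ⟨pullback k' k₁, hQ.pullback _ _ hB hB₁ (hPQ _ t'.1.left.unop.property),
            pullback.lift h h₁ (hk'.trans hk₁.symm), pullback.fst _ _ ≫ k,
            pullback.snd _ _ ≫ k₁', by rw [pullback.lift_fst_assoc, hk],
            by rw [pullback.lift_snd_assoc, hk₁'], ?_⟩
          rw [← map_op_map_op, ← map_op_map_op, e, ← e₁, map_op_map_op, map_op_map_op,
            pullback.condition] }
    refine rel_of_isColimit (hφ (op X)) R hR ?_
      (j := CostructuredArrow.mk (Y := op (⟨A, hA⟩ : P.FullSubcategory)) (S := P.ι.op)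
        (Quiver.Hom.op (X := X) (Y := A) f))
      (j' := CostructuredArrow.mk (Y := op (⟨A', hA'⟩ : P.FullSubcategory)) (S := P.ι.op)
        (Quiver.Hom.op (X := X) (Y := A') f')) (x := y) (x' := y') hy
    intro j j' g x
    refine ⟨_, hPQ _ j'.left.unop.property, j'.hom.unop, g.left.unop.hom, 𝟙 _,
      congrArg Quiver.Hom.unop (CostructuredArrow.w g), Category.comp_id _, ?_⟩
    rw [op_id, Functor.map_id_apply]
    rfl

/-- A small family of small presheaves is small relative to a single subcategory. -/
theorem exists_smallOn_family {I : Type w} [Small.{v} I] (φ : I → Cᵒᵖ ⥤ Type v)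
    (h : ∀ i, IsSmallPresheaf (φ i)) :
    ∃ P : ObjectProperty C, IsSmallLex P ∧ ∀ i, SmallOn P (φ i) := by
  choose P hP hφ using fun i => (h i).exists_smallOn
  have (i : I) : ObjectProperty.EssentiallySmall.{v} (P i) := (hP i).small
  obtain ⟨Q, hQ, hPQ⟩ := exists_isSmallLex_ge (⨆ i, P i) inferInstance
  exact ⟨Q, hQ, fun i => (hφ i).mono hQ (le_trans (le_iSup P i) hPQ)⟩

end

/-! ### Limits of presheaves and of small presheaves -/

section

variable {C : Type u} [Category.{v} C]

theorem nonempty_isLimit_of_existsUnique {J : Type u₁} [Category.{v₁} J] {F : J ⥤ Cᵒᵖ ⥤ Type w}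
    (t : Cone F) (h : ∀ (X : Cᵒᵖ) (x : ∀ j, (F.obj j).obj X),
      (∀ ⦃j j' : J⦄ (g : j ⟶ j'), (F.map g).app X (x j) = x j') →
        ∃! z : t.pt.obj X, ∀ j, (t.π.app j).app X z = x j) : Nonempty (IsLimit t) :=
  ⟨evaluationJointlyReflectsLimits _ fun X => Nonempty.some
    ((Types.isLimit_iff _).2 fun x hx => h X x (fun _ _ g => hx g))⟩

theorem existsUnique_of_isLimit {J : Type u₁} [Category.{v₁} J] [HasLimitsOfShape J (Type w)]
    {F : J ⥤ Cᵒᵖ ⥤ Type w} {t : Cone F} (ht : IsLimit t) (X : Cᵒᵖ) (x : ∀ j, (F.obj j).obj X)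
    (hx : ∀ ⦃j j' : J⦄ (g : j ⟶ j'), (F.map g).app X (x j) = x j') :
    ∃! z : t.pt.obj X, ∀ j, (t.π.app j).app X z = x j :=
  (Types.isLimit_iff _).1 ⟨isLimitOfPreserves ((evaluation _ _).obj X) ht⟩ x (fun g => hx g)

/-- A full subcategory of presheaves that contains the representables is included by a functor
that preserves all limits: elements of a presheaf are maps out of representables. -/
theorem preservesLimitsOfShape_of_representables {A : Type u₁} [Category.{v₁} A]
    (U : A ⥤ Cᵒᵖ ⥤ Type v) [U.Full] [U.Faithful]
    (hU : ∀ X : C, ∃ a : A, Nonempty (U.obj a ≅ yoneda.obj X))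
    (J : Type*) [Category* J] : PreservesLimitsOfShape J U where
  preservesLimit {F} := ⟨fun {t} ht => by
    refine nonempty_isLimit_of_existsUnique _ fun X x hx => ?_
    obtain ⟨a, ⟨e⟩⟩ := hU X.unop
    let E (b : A) : (a ⟶ b) ≃ (U.obj b).obj X :=
      ((Functor.FullyFaithful.ofFullyFaithful U).homEquiv).trans
        ((e.homFromEquiv (Z := U.obj b)).trans yonedaEquiv)
    have hE {b b' : A} (f : a ⟶ b) (g : b ⟶ b') : E b' (f ≫ g) = (U.map g).app X (E b f) := by
      change yonedaEquiv (e.inv ≫ U.map (f ≫ g)) = (U.map g).app X (yonedaEquiv (e.inv ≫ U.map f))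
      rw [U.map_comp, ← Category.assoc]
      exact yonedaEquiv_comp _ _
    let s : Cone F :=
      { pt := a
        π :=
          { app := fun j => (E _).symm (x j)
            naturality := fun j j' g => by
              apply (E _).injective
              refine (congrArg (E _) (Category.id_comp ((E _).symm (x j')))).trans ?_
              rw [hE, Equiv.apply_symm_apply, Equiv.apply_symm_apply]
              exact (hx g).symm } }
    refine ⟨E _ (ht.lift s), fun j => ?_, fun z hz => ?_⟩
    · have := (hE (ht.lift s) (t.π.app j)).symm
      rw [ht.fac] at this
      exact this.trans ((E _).apply_symm_apply _)
    · refine ((E _).apply_symm_apply z).symm.trans (congrArg (E _) (ht.uniq s _ fun j => ?_))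
      apply (E _).injective
      rw [hE, Equiv.apply_symm_apply]
      exact (hz j).trans ((E _).apply_symm_apply _).symm⟩

/-- Maps of small presheaves out of a representable are elements. -/
def smallYonedaEquiv {X : C} {φ : SmallPsh C} :
    ((smallYoneda C).obj X ⟶ φ) ≃ φ.obj.obj (op X) where
  toFun f := yonedaEquiv f.hom
  invFun x := ObjectProperty.homMk (yonedaEquiv.symm x)
  left_inv f := ObjectProperty.hom_ext _ (yonedaEquiv.symm_apply_apply f.hom)
  right_inv x := yonedaEquiv.apply_symm_apply x

theorem smallYonedaEquiv_comp {X : C} {φ ψ : SmallPsh C} (a : (smallYoneda C).obj X ⟶ φ)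
    (f : φ ⟶ ψ) : smallYonedaEquiv (a ≫ f) = f.hom.app _ (smallYonedaEquiv a) :=
  rfl

theorem smallYonedaEquiv_symm_comp {X : C} {φ ψ : SmallPsh C} (x : φ.obj.obj (op X))
    (f : φ ⟶ ψ) : smallYonedaEquiv.symm x ≫ f = smallYonedaEquiv.symm (f.hom.app _ x) := by
  apply smallYonedaEquiv.injective
  rw [smallYonedaEquiv_comp, Equiv.apply_symm_apply, Equiv.apply_symm_apply]

theorem smallPsh_hom_ext {φ ψ : SmallPsh C} {f g : φ ⟶ ψ}
    (h : ∀ (X : C) (x : φ.obj.obj (op X)), f.hom.app _ x = g.hom.app _ x) : f = g := by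
  ext X x
  exact h X.unop x

instance : (smallYoneda C).Full := by
  have : (smallYoneda C ⋙ ObjectProperty.ι _).Full := inferInstanceAs (yoneda (C := C)).Full
  exact Functor.Full.of_comp_faithful (smallYoneda C) (ObjectProperty.ι _)

instance : (smallYoneda C).Faithful := by
  have : (smallYoneda C ⋙ ObjectProperty.ι _).Faithful :=
    inferInstanceAs (yoneda (C := C)).Faithful
  exact Functor.Faithful.of_comp (smallYoneda C) (ObjectProperty.ι _)

instance smallPsh_ι_preservesLimitsOfShape (J : Type*) [Category* J] :
    PreservesLimitsOfShape J (IsSmallPresheaf (C := C)).ι :=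
  preservesLimitsOfShape_of_representables _ (fun X => ⟨(smallYoneda C).obj X, ⟨Iso.refl _⟩⟩) J

instance smallYoneda_preservesLimitsOfShape (J : Type*) [Category* J] :
    PreservesLimitsOfShape J (smallYoneda C) := by
  have : PreservesLimitsOfShape J (smallYoneda C ⋙ IsSmallPresheaf.ι) :=
    inferInstanceAs (PreservesLimitsOfShape J (yoneda (C := C)))
  exact preservesLimitsOfShape_of_reflects_of_preserves (smallYoneda C) IsSmallPresheaf.ι

theorem injective_of_mono {φ ψ : SmallPsh C} (f : φ ⟶ ψ) [Mono f] (X : Cᵒᵖ) :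
    Function.Injective (f.hom.app X) := by
  intro x y h
  apply (smallYonedaEquiv (X := X.unop)).symm.injective
  rw [← cancel_mono f, smallYonedaEquiv_symm_comp, smallYonedaEquiv_symm_comp]
  exact congrArg _ h

theorem mono_of_injective {φ ψ : SmallPsh C} (f : φ ⟶ ψ)
    (h : ∀ X, Function.Injective (f.hom.app (op X))) : Mono f where
  right_cancellation _ _ hab := smallPsh_hom_ext fun X x => h X
    (ConcreteCategory.congr_hom
      (NatTrans.congr_app (congrArg InducedCategory.Hom.hom hab) (op X)) x)

theorem isPullback_exists {π φ χ ψ : SmallPsh C} {p : π ⟶ φ} {q : π ⟶ χ} {f : φ ⟶ ψ}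
    {g : χ ⟶ ψ} (h : IsPullback p q f g) {X : Cᵒᵖ} {a : φ.obj.obj X}
    {b : χ.obj.obj X} (hab : f.hom.app X a = g.hom.app X b) :
    ∃ x : π.obj.obj X, p.hom.app X x = a ∧ q.hom.app X x = b :=
  Types.exists_of_isPullback ((h.map IsSmallPresheaf.ι).map ((evaluation _ _).obj X)) a b hab

theorem isPullback_ext {π φ χ ψ : SmallPsh C} {p : π ⟶ φ} {q : π ⟶ χ} {f : φ ⟶ ψ}
    {g : χ ⟶ ψ} (h : IsPullback p q f g) {X : Cᵒᵖ} {x y : π.obj.obj X}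
    (hp : p.hom.app X x = p.hom.app X y) (hq : q.hom.app X x = q.hom.app X y) : x = y :=
  Types.ext_of_isPullback ((h.map IsSmallPresheaf.ι).map ((evaluation _ _).obj X)) hp hq

variable [HasFiniteLimits C]

/-- Choosing one small lex subcategory that serves all three presheaves, the finite limits of that
subcategory combine their witnesses. -/
theorem isSmallPresheaf_pullback {π φ χ ψ : Cᵒᵖ ⥤ Type v} {p : π ⟶ φ} {q : π ⟶ χ} {f : φ ⟶ ψ}
    {g : χ ⟶ ψ} (h : IsPullback p q f g) (hφ : IsSmallPresheaf φ) (hχ : IsSmallPresheaf χ)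
    (hψ : IsSmallPresheaf ψ) : IsSmallPresheaf π := by
  obtain ⟨P, hP, hs⟩ := exists_smallOn_family (fun i : Fin 3 => ![φ, χ, ψ] i)
    (fun i => by fin_cases i; exacts [hφ, hχ, hψ])
  have hφ : SmallOn P φ := hs 0
  have hχ : SmallOn P χ := hs 1
  have hψ : SmallOn P ψ := hs 2
  have hex {X : Cᵒᵖ} := Types.exists_of_isPullback (h.map ((evaluation _ _).obj X))
  have hext {X : Cᵒᵖ} {x y : π.obj X} (h₁ : p.app X x = p.app X y)
      (h₂ : q.app X x = q.app X y) : x = y :=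
    Types.ext_of_isPullback (h.map ((evaluation _ _).obj X)) h₁ h₂
  have hw {X : Cᵒᵖ} (x : π.obj X) : f.app X (p.app X x) = g.app X (q.app X x) :=
    ConcreteCategory.congr_hom (NatTrans.congr_app h.w X) x
  refine SmallOn.isSmallPresheaf hP ⟨fun X x => ?_, ?_⟩
  · obtain ⟨A, hA, a, y, hy⟩ := hφ.exists_factor X (p.app _ x)
    obtain ⟨A', hA', a', y', hy'⟩ := hχ.exists_factor X (q.app _ x)
    obtain ⟨B, hB, b, k, k', rfl, rfl, hk⟩ := hψ.exists_eq hA hA' a a' (f.app _ y) (g.app _ y')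
      (by rw [← NatTrans.naturality_apply, ← NatTrans.naturality_apply, hy, hy', hw])
    obtain ⟨z, hz₁, hz₂⟩ := hex (φ.map k.op y) (χ.map k'.op y') (by
      have := hk
      rw [← NatTrans.naturality_apply, ← NatTrans.naturality_apply] at this
      exact this)
    refine ⟨B, hB, b, z, hext ?_ ?_⟩
    · rw [NatTrans.naturality_apply]
      exact (congrArg (φ.map b.op) hz₁).trans ((map_op_map_op _ _ _ _).trans hy)
    · rw [NatTrans.naturality_apply]
      exact (congrArg (χ.map b.op) hz₂).trans ((map_op_map_op _ _ _ _).trans hy')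
  · intro X A A' hA hA' a a' y y' hy
    obtain ⟨B₁, hB₁, b₁, k₁, k₁', hb₁, hb₁', e₁⟩ := hφ.exists_eq hA hA' a a'
      (p.app _ y) (p.app _ y')
      (by rw [← NatTrans.naturality_apply, ← NatTrans.naturality_apply, hy])
    obtain ⟨B₂, hB₂, b₂, k₂, k₂', hb₂, hb₂', e₂⟩ := hχ.exists_eq hA hA' a a'
      (q.app _ y) (q.app _ y')
      (by rw [← NatTrans.naturality_apply, ← NatTrans.naturality_apply, hy])
    obtain ⟨D, hD, d, d', hdd⟩ := hP.exists_prod hA hA'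
    obtain ⟨t₁, ⟨h₁, h₁'⟩, -⟩ := hdd k₁ k₁'
    obtain ⟨t₂, ⟨h₂, h₂'⟩, -⟩ := hdd k₂ k₂'
    have ht : b₁ ≫ t₁ = b₂ ≫ t₂ := by
      refine (hdd a a').unique ⟨?_, ?_⟩ ⟨?_, ?_⟩ <;> rw [Category.assoc]
      exacts [h₁.symm ▸ hb₁, h₁'.symm ▸ hb₁', h₂.symm ▸ hb₂, h₂'.symm ▸ hb₂']
    have hc : pullback.snd t₁ t₂ ≫ k₂ = pullback.fst t₁ t₂ ≫ k₁ := by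
      rw [← h₁, ← h₂, pullback.condition_assoc]
    have hc' : pullback.snd t₁ t₂ ≫ k₂' = pullback.fst t₁ t₂ ≫ k₁' := by
      rw [← h₁', ← h₂', pullback.condition_assoc]
    refine ⟨pullback t₁ t₂, hP.pullback _ _ hB₁ hB₂ hD, pullback.lift b₁ b₂ ht,
      pullback.fst _ _ ≫ k₁, pullback.fst _ _ ≫ k₁', by rw [pullback.lift_fst_assoc, hb₁],
      by rw [pullback.lift_fst_assoc, hb₁'], hext ?_ ?_⟩
    · rw [NatTrans.naturality_apply, NatTrans.naturality_apply, ← map_op_map_op, e₁, map_op_map_op]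
    · rw [NatTrans.naturality_apply, NatTrans.naturality_apply, ← hc, ← hc', ← map_op_map_op, e₂,
        map_op_map_op]

instance : HasPullbacks (SmallPsh C) := by
  have : ∀ {φ χ ψ : SmallPsh C} {f : φ ⟶ ψ} {g : χ ⟶ ψ}, HasLimit (cospan f g) := by
    intro φ χ ψ f g
    let h := IsPullback.of_hasPullback f.hom g.hom
    let π : SmallPsh C := ⟨_, isSmallPresheaf_pullback h φ.property χ.property ψ.property⟩
    let p : π ⟶ φ := ObjectProperty.homMk (pullback.fst f.hom g.hom)
    let q : π ⟶ χ := ObjectProperty.homMk (pullback.snd f.hom g.hom)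
    have h' : IsPullback p q f g :=
      IsPullback.of_map IsSmallPresheaf.ι (ObjectProperty.hom_ext _ h.w) h
    exact h'.hasPullback
  exact hasPullbacks_of_hasLimit_cospan _

instance : HasTerminal (SmallPsh C) :=
  (IsTerminal.isTerminalObj (smallYoneda C) (⊤_ C) terminalIsTerminal).hasTerminal

instance : HasFiniteLimits (SmallPsh C) :=
  hasFiniteLimits_of_hasTerminal_and_pullbacks

end

/-! ### Weighted colimits of presheaves, elementwise -/

section

variable {K : Type v} [SmallCategory K] {A : Type u₁} [Category.{v₁} A]
  {B : Type*} [Category* B]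

/-- The image of a weighted cocone under a functor. -/
@[simps]
def WeightedCocone.map {φ : Kᵒᵖ ⥤ Type v} {D : K ⥤ A} {c : A} (γ : WeightedCocone φ D c)
    (F : A ⥤ B) : WeightedCocone φ (D ⋙ F) (F.obj c) where
  app k x := F.map (γ.app k x)
  naturality k k' g x := by
    rw [γ.naturality, F.map_comp]
    rfl

/-- Extension of a weighted cocone along a morphism out of its vertex. -/
@[simps]
def WeightedCocone.postcomp {φ : Kᵒᵖ ⥤ Type v} {D : K ⥤ A} {c c' : A} (γ : WeightedCocone φ D c)
    (h : c ⟶ c') : WeightedCocone φ D c' where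
  app k x := γ.app k x ≫ h
  naturality k k' g x := by rw [γ.naturality, Category.assoc]

/-- Restriction of a weighted cocone along a transformation of diagrams. -/
@[simps]
def WeightedCocone.precomp {φ : Kᵒᵖ ⥤ Type v} {D D' : K ⥤ A} {c : A} (γ : WeightedCocone φ D' c)
    (a : D ⟶ D') : WeightedCocone φ D c where
  app k x := a.app k ≫ γ.app k x
  naturality k k' g x := by rw [γ.naturality, ← a.naturality_assoc]

theorem WeightedCocone.IsColimit.hom_ext {φ : Kᵒᵖ ⥤ Type v} {D : K ⥤ A} {c c' : A}
    {γ : WeightedCocone φ D c} (hγ : γ.IsColimit) {f g : c ⟶ c'}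
    (h : ∀ k x, γ.app k x ≫ f = γ.app k x ≫ g) : f = g :=
  (hγ (γ.postcomp g)).unique h fun _ _ => rfl

end

section

variable {C : Type u} [Category.{v} C] {K : Type v} [SmallCategory K]

/-- The elementary identifications in the coend that computes the weighted colimit `φ ⋆ D` of a
diagram of presheaves at the object `X`. -/
def WeightedRel (φ : Kᵒᵖ ⥤ Type v) (D : K ⥤ Cᵒᵖ ⥤ Type v) (X : Cᵒᵖ)
    (t t' : Σ k : K, φ.obj (op k) × (D.obj k).obj X) : Prop :=
  ∃ g : t.1 ⟶ t'.1, t.2.1 = φ.map g.op t'.2.1 ∧ t'.2.2 = (D.map g).app X t.2.2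

variable {φ : Kᵒᵖ ⥤ Type v} {D : K ⥤ Cᵒᵖ ⥤ Type v} {ψ : Cᵒᵖ ⥤ Type v}

theorem WeightedCocone.naturality_app (γ : WeightedCocone φ D ψ) {k k' : K} (g : k ⟶ k')
    (p : φ.obj (op k')) {X : Cᵒᵖ} (d : (D.obj k).obj X) :
    (γ.app k (φ.map g.op p)).app X d = (γ.app k' p).app X ((D.map g).app X d) :=
  ConcreteCategory.congr_hom (NatTrans.congr_app (γ.naturality g p) X) d

theorem WeightedCocone.app_eq_of_eqvGen (γ : WeightedCocone φ D ψ) {X : Cᵒᵖ}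
    {t t' : Σ k : K, φ.obj (op k) × (D.obj k).obj X}
    (h : Relation.EqvGen (WeightedRel φ D X) t t') :
    (γ.app t.1 t.2.1).app X t.2.2 = (γ.app t'.1 t'.2.1).app X t'.2.2 := by
  induction h with
  | rel t t' h =>
    obtain ⟨g, h₁, h₂⟩ := h
    rw [h₁, h₂, γ.naturality_app]
  | refl => rfl
  | symm _ _ _ ih => exact ih.symm
  | trans _ _ _ _ _ ih₁ ih₂ => exact ih₁.trans ih₂

/-- A weighted cocone of presheaves is pointwise when its vertex is, objectwise, the coend that
computes the weighted colimit. -/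
structure WeightedCocone.IsPointwise (γ : WeightedCocone φ D ψ) : Prop where
  exists_rep : ∀ (X : Cᵒᵖ) (x : ψ.obj X), ∃ (k : K) (p : φ.obj (op k)) (d : (D.obj k).obj X),
    (γ.app k p).app X d = x
  eqvGen : ∀ (X : Cᵒᵖ) (t t' : Σ k : K, φ.obj (op k) × (D.obj k).obj X),
    (γ.app t.1 t.2.1).app X t.2.2 = (γ.app t'.1 t'.2.1).app X t'.2.2 →
      Relation.EqvGen (WeightedRel φ D X) t t'

theorem WeightedCocone.IsPointwise.isColimit {γ : WeightedCocone φ D ψ} (hγ : γ.IsPointwise) :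
    γ.IsColimit := by
  intro χ θ
  choose k p d hd using hγ.exists_rep
  have key (X : Cᵒᵖ) (k' : K) (p' : φ.obj (op k')) (d' : (D.obj k').obj X) :
      (θ.app _ (p X ((γ.app k' p').app X d'))).app X (d X ((γ.app k' p').app X d')) =
        (θ.app k' p').app X d' :=
    θ.app_eq_of_eqvGen (t := ⟨_, p X ((γ.app k' p').app X d'), d X ((γ.app k' p').app X d')⟩)
      (t' := ⟨k', p', d'⟩) (hγ.eqvGen X _ _ (hd X _))
  let h : ψ ⟶ χ :=
    { app := fun X => TypeCat.ofHom fun x => (θ.app _ (p X x)).app X (d X x)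
      naturality := fun X Y f => by
        ext x
        have h₁ := key Y _ (p X x) ((D.obj _).map f (d X x))
        rw [NatTrans.naturality_apply, hd] at h₁
        exact h₁.trans (NatTrans.naturality_apply _ _ _) }
  refine ⟨h, fun k' p' => ?_, fun h' hh' => ?_⟩
  · ext X d'
    exact key X k' p' d'
  · ext X x
    have := ConcreteCategory.congr_hom (NatTrans.congr_app (hh' _ (p X x)) X) (d X x)
    refine Eq.trans ?_ this
    exact congrArg (h'.app X) (hd X x).symm

/-- The pointwise weighted colimit of a diagram of presheaves. -/
def weightedColimit (φ : Kᵒᵖ ⥤ Type v) (D : K ⥤ Cᵒᵖ ⥤ Type v) : Cᵒᵖ ⥤ Type v where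
  obj X := Quot (WeightedRel φ D X)
  map {X Y} f := TypeCat.ofHom (Quot.map (fun t => ⟨t.1, t.2.1, (D.obj t.1).map f t.2.2⟩) (by
    rintro t t' ⟨g, h₁, h₂⟩
    exact ⟨g, h₁, (congrArg _ h₂).trans (NatTrans.naturality_apply (D.map g) f t.2.2).symm⟩))
  map_id X := by
    ext ⟨t⟩
    change Quot.mk _ _ = Quot.mk _ _
    simp
  map_comp f g := by
    ext ⟨t⟩
    change Quot.mk _ _ = Quot.mk _ _
    simp

/-- The weighted cocone under the pointwise weighted colimit. -/
def weightedColimitCocone (φ : Kᵒᵖ ⥤ Type v) (D : K ⥤ Cᵒᵖ ⥤ Type v) :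
    WeightedCocone φ D (weightedColimit φ D) where
  app k p :=
    { app := fun X => TypeCat.ofHom fun d => Quot.mk _ ⟨k, p, d⟩
      naturality := fun _ _ _ => rfl }
  naturality k k' g p := by
    ext X d
    exact Quot.sound ⟨g, rfl, rfl⟩

theorem weightedColimitCocone_isPointwise (φ : Kᵒᵖ ⥤ Type v) (D : K ⥤ Cᵒᵖ ⥤ Type v) :
    (weightedColimitCocone φ D).IsPointwise where
  exists_rep X := by
    rintro ⟨k, p, d⟩
    exact ⟨k, p, d, rfl⟩
  eqvGen X t t' h := Quot.eqvGen_exact h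

theorem WeightedCocone.IsPointwise.isSmallPresheaf [HasFiniteLimits C] {γ : WeightedCocone φ D ψ}
    (hγ : γ.IsPointwise) (hD : ∀ k, IsSmallPresheaf (D.obj k)) : IsSmallPresheaf ψ := by
  obtain ⟨P, hP, hs⟩ := exists_smallOn_family D.obj hD
  refine SmallOn.isSmallPresheaf hP ⟨fun X x => ?_, ?_⟩
  · obtain ⟨k, p, d, rfl⟩ := hγ.exists_rep _ x
    obtain ⟨A, hA, f, y, rfl⟩ := (hs k).exists_factor X d
    exact ⟨A, hA, f, (γ.app k p).app _ y, (NatTrans.naturality_apply _ _ _).symm⟩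
  · intro X A A' hA hA' f f' y y' h
    obtain ⟨k, p, d, rfl⟩ := hγ.exists_rep _ y
    obtain ⟨k', p', d', rfl⟩ := hγ.exists_rep _ y'
    rw [← NatTrans.naturality_apply, ← NatTrans.naturality_apply] at h
    -- Any two factorizations of equivalent representatives agree over an object of `P`.
    have key (t t' : Σ k : K, φ.obj (op k) × (D.obj k).obj (op X))
        (h : Relation.EqvGen (WeightedRel φ D (op X)) t t') :
        ∀ ⦃A A' : C⦄, P A → P A' → ∀ (f : X ⟶ A) (f' : X ⟶ A') (d : (D.obj t.1).obj (op A))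
          (d' : (D.obj t'.1).obj (op A')), (D.obj t.1).map f.op d = t.2.2 →
          (D.obj t'.1).map f'.op d' = t'.2.2 →
          ∃ (B : C) (_ : P B) (e : X ⟶ B) (l : B ⟶ A) (l' : B ⟶ A'), e ≫ l = f ∧ e ≫ l' = f' ∧
            ψ.map l.op ((γ.app t.1 t.2.1).app _ d) =
              ψ.map l'.op ((γ.app t'.1 t'.2.1).app _ d') := by
      induction h with
      | rel t t' h =>
        obtain ⟨g, h₁, h₂⟩ := h
        intro A A' hA hA' f f' d d' hd hd'
        obtain ⟨B, hB, e, l, l', hl, hl', hll⟩ := (hs t'.1).exists_eq hA hA' f f'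
          ((D.map g).app _ d) d' (by rw [← NatTrans.naturality_apply, hd, hd', h₂])
        refine ⟨B, hB, e, l, l', hl, hl', ?_⟩
        rw [h₁, γ.naturality_app, ← NatTrans.naturality_apply, hll, NatTrans.naturality_apply]
      | refl t =>
        intro A A' hA hA' f f' d d' hd hd'
        obtain ⟨B, hB, e, l, l', hl, hl', hll⟩ := (hs t.1).exists_eq hA hA' f f' d d'
          (hd.trans hd'.symm)
        refine ⟨B, hB, e, l, l', hl, hl', ?_⟩
        rw [← NatTrans.naturality_apply, ← NatTrans.naturality_apply, hll]
      | symm t t' _ ih =>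
        intro A A' hA hA' f f' d d' hd hd'
        obtain ⟨B, hB, e, l, l', hl, hl', hll⟩ := ih hA' hA f' f d' d hd' hd
        exact ⟨B, hB, e, l', l, hl', hl, hll.symm⟩
      | trans t t' t'' _ _ ih₁ ih₂ =>
        intro A A'' hA hA'' f f'' d d'' hd hd''
        obtain ⟨A', hA', f', d', hd'⟩ := (hs t'.1).exists_factor X t'.2.2
        obtain ⟨B₁, hB₁, e₁, l₁, l₁', hl₁, hl₁', h₁⟩ := ih₁ hA hA' f f' d d' hd hd'
        obtain ⟨B₂, hB₂, e₂, l₂, l₂', hl₂, hl₂', h₂⟩ := ih₂ hA' hA'' f' f'' d' d'' hd' hd''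
        refine ⟨pullback l₁' l₂, hP.pullback _ _ hB₁ hB₂ hA',
          pullback.lift e₁ e₂ (hl₁'.trans hl₂.symm), pullback.fst _ _ ≫ l₁,
          pullback.snd _ _ ≫ l₂', by rw [pullback.lift_fst_assoc, hl₁],
          by rw [pullback.lift_snd_assoc, hl₂'], ?_⟩
        rw [← map_op_map_op, h₁, ← map_op_map_op, ← h₂, map_op_map_op, map_op_map_op,
          pullback.condition]
    exact key _ _ (hγ.eqvGen _ ⟨k, p, (D.obj k).map f.op d⟩ ⟨k', p', (D.obj k').map f'.op d'⟩ h)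
      hA hA' f f' d d' rfl rfl

theorem WeightedCocone.isColimit_of_isPointwise {D : K ⥤ SmallPsh C} {ψ : SmallPsh C}
    {γ : WeightedCocone φ D ψ} (hγ : (γ.map IsSmallPresheaf.ι).IsPointwise) : γ.IsColimit := by
  intro χ θ
  obtain ⟨h, hh, hu⟩ := hγ.isColimit (θ.map IsSmallPresheaf.ι)
  refine ⟨ObjectProperty.homMk h, fun k x => ObjectProperty.hom_ext _ (hh k x), fun h' hh' =>
    ObjectProperty.hom_ext _ (hu _ fun k x => congrArg InducedCategory.Hom.hom (hh' k x))⟩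

/-- Weighted colimits in `𝒫 C` are computed pointwise, because pointwise weighted colimits of small
presheaves are small. -/
theorem WeightedCocone.IsColimit.isPointwise [HasFiniteLimits C] {D : K ⥤ SmallPsh C}
    {ψ : SmallPsh C} {γ : WeightedCocone φ D ψ} (hγ : γ.IsColimit) :
    (γ.map IsSmallPresheaf.ι).IsPointwise := by
  let γ₀ := weightedColimitCocone φ (D ⋙ IsSmallPresheaf.ι)
  have hγ₀ : γ₀.IsPointwise := weightedColimitCocone_isPointwise _ _
  let G : SmallPsh C := ⟨_, hγ₀.isSmallPresheaf fun k => (D.obj k).property⟩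
  let γ₁ : WeightedCocone φ D G :=
    { app := fun k p => ObjectProperty.homMk (γ₀.app k p)
      naturality := fun k k' g p => ObjectProperty.hom_ext _ (γ₀.naturality g p) }
  have hγ₁ : γ₁.IsColimit := WeightedCocone.isColimit_of_isPointwise hγ₀
  obtain ⟨h, hh, -⟩ := hγ γ₁
  obtain ⟨h', hh', -⟩ := hγ₁ γ
  have hinv : h ≫ h' = 𝟙 ψ := hγ.hom_ext fun k x => by
    rw [reassoc_of% (hh k x), hh', Category.comp_id]
  have hh_app {X : Cᵒᵖ} (k : K) (p : φ.obj (op k)) (d : (D.obj k).obj.obj X) :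
      h.hom.app X ((γ.app k p).hom.app X d) = (γ₀.app k p).app X d :=
    ConcreteCategory.congr_hom
      (NatTrans.congr_app (congrArg InducedCategory.Hom.hom (hh k p)) X) d
  have hh'_app {X : Cᵒᵖ} (k : K) (p : φ.obj (op k)) (d : (D.obj k).obj.obj X) :
      h'.hom.app X ((γ₀.app k p).app X d) = (γ.app k p).hom.app X d :=
    ConcreteCategory.congr_hom
      (NatTrans.congr_app (congrArg InducedCategory.Hom.hom (hh' k p)) X) d
  refine ⟨fun X x => ?_, fun X t t' htt' => hγ₀.eqvGen X t t' ?_⟩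
  · obtain ⟨k, p, d, hd⟩ := hγ₀.exists_rep X (h.hom.app X x)
    refine ⟨k, p, d, (hh'_app k p d).symm.trans ?_⟩
    rw [hd]
    exact ConcreteCategory.congr_hom
      (NatTrans.congr_app (congrArg InducedCategory.Hom.hom hinv) X) x
  · have := congrArg (h.hom.app X) htt'
    exact (hh_app t.1 t.2.1 t.2.2).symm.trans (this.trans (hh_app t'.1 t'.2.1 t'.2.2))

/-- The weighted cocone under a diagram of representables that corresponds to a transformation
`α`. -/
def coconeOfLan {D : K ⥤ C} (α : φ ⟶ D.op ⋙ ψ) : WeightedCocone φ (D ⋙ yoneda) ψ where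
  app k p := yonedaEquiv.symm (α.app (op k) p)
  naturality k k' g p := by
    rw [NatTrans.naturality_apply]
    exact yonedaEquiv_symm_map (D.map g).op _

/-- A left Kan extension `Lan_{Dᵒᵖ} φ` is the weighted colimit of the representables on `D`. -/
theorem coconeOfLan_isPointwise {D : K ⥤ C} {α : φ ⟶ D.op ⋙ ψ}
    (h : (Functor.LeftExtension.mk (L := D.op) ψ α).IsPointwiseLeftKanExtension) :
    (coconeOfLan α).IsPointwise where
  exists_rep X x := by
    obtain ⟨j, p, hp⟩ := Types.jointly_surjective_of_isColimit (h X) x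
    exact ⟨j.left.unop, p, j.hom.unop, hp⟩
  eqvGen X t t' htt' := by
    let E (s : Σ j, (CostructuredArrow.proj D.op X ⋙ φ).obj j) :
        Σ k : K, φ.obj (op k) × ((D ⋙ yoneda).obj k).obj X :=
      ⟨s.1.left.unop, s.2, s.1.hom.unop⟩
    have hR : Equivalence fun s s' => Relation.EqvGen (WeightedRel φ (D ⋙ yoneda) X) (E s) (E s') :=
      { refl := fun s => .refl _
        symm := fun h => .symm _ _ h
        trans := fun h h' => .trans _ _ _ h h' }
    exact rel_of_isColimit (h X) _ hR (fun j j' g p => .symm _ _ (.rel _ _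
        ⟨g.left.unop, rfl, congrArg Quiver.Hom.unop (CostructuredArrow.w g).symm⟩))
      (j := CostructuredArrow.mk (Y := op t.1) (S := D.op)
        (Quiver.Hom.op (X := X.unop) (Y := D.obj t.1) t.2.2))
      (j' := CostructuredArrow.mk (Y := op t'.1) (S := D.op)
        (Quiver.Hom.op (X := X.unop) (Y := D.obj t'.1) t'.2.2)) (x := t.2.1) (x' := t'.2.1) htt'

end

/-! ### Bidense morphisms for the canonical topology -/

section

variable {C : Type u} [Category.{v} C]

/-- A morphism of presheaves is bidense when it is locally bijective for the canonical topology,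
that is, for the finest topology for which the representables are sheaves. -/
structure IsBidense {φ ψ : Cᵒᵖ ⥤ Type v} (f : φ ⟶ ψ) : Prop where
  surj : Presheaf.IsLocallySurjective (Sheaf.canonicalTopology C) f
  inj : Presheaf.IsLocallyInjective (Sheaf.canonicalTopology C) f

theorem isBidense_of_isIso {φ ψ : Cᵒᵖ ⥤ Type v} (f : φ ⟶ ψ) [IsIso f] : IsBidense f :=
  ⟨inferInstance, inferInstance⟩

theorem IsBidense.comp {φ ψ χ : Cᵒᵖ ⥤ Type v} {f : φ ⟶ ψ} {g : ψ ⟶ χ} (hf : IsBidense f)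
    (hg : IsBidense g) : IsBidense (f ≫ g) := by
  have := hf.1; have := hf.2; have := hg.1; have := hg.2
  exact ⟨inferInstance, inferInstance⟩

theorem IsBidense.of_comp {φ ψ χ : Cᵒᵖ ⥤ Type v} {f : φ ⟶ ψ} {g : ψ ⟶ χ} (hf : IsBidense f)
    (hfg : IsBidense (f ≫ g)) : IsBidense g := by
  have := hf.1; have := hf.2; have := hfg.1; have := hfg.2
  exact ⟨Presheaf.isLocallySurjective_of_isLocallySurjective _ f g,
    Presheaf.isLocallyInjective_of_isLocallyInjective_of_isLocallySurjective _ f g⟩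

/-- Bidense morphisms are orthogonal to sheaves for the canonical topology. -/
theorem IsBidense.existsUnique_extension {φ ψ F : Cᵒᵖ ⥤ Type v} {f : φ ⟶ ψ} (hf : IsBidense f)
    (hF : Presieve.IsSheaf (Sheaf.canonicalTopology C) F) (g : φ ⟶ F) :
    ∃! h : ψ ⟶ F, f ≫ h = g := by
  have := hf.1; have := hf.2
  -- Elements identified by `f` agree locally, so `g` identifies them.
  have hg {X : Cᵒᵖ} {t t' : φ.obj X} (h : f.app X t = f.app X t') : g.app X t = g.app X t' := by
    refine (hF.isSeparated _ (Presheaf.equalizerSieve_mem _ f t t' h)).ext fun Y i hi => ?_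
    rw [← NatTrans.naturality_apply, ← NatTrans.naturality_apply]
    exact congrArg _ hi
  -- The extension at `x` is the amalgamation of the values of `g` at the local lifts of `x`.
  have key (X : Cᵒᵖ) (x : ψ.obj X) : ∃! z : F.obj X, ∀ (Y : C) (i : Y ⟶ X.unop)
      (t : φ.obj (op Y)), f.app _ t = ψ.map i.op x → F.map i.op z = g.app _ t := by
    have hS := Presheaf.imageSieve_mem (Sheaf.canonicalTopology C) f x
    let a : Presieve.FamilyOfElements F (Presheaf.imageSieve f x).arrows := fun Y i hi =>
      g.app _ (Presheaf.localPreimage f x i hi)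
    have ha : a.Compatible := by
      intro Y₁ Y₂ Z g₁ g₂ i₁ i₂ h₁ h₂ hc
      change F.map g₁.op (g.app _ _) = F.map g₂.op (g.app _ _)
      rw [← NatTrans.naturality_apply, ← NatTrans.naturality_apply]
      apply hg
      rw [NatTrans.naturality_apply, NatTrans.naturality_apply, Presheaf.app_localPreimage,
        Presheaf.app_localPreimage]
      exact (map_op_map_op (X := Z) ψ g₁ i₁ x).trans
        ((congrArg (fun k => ψ.map (Quiver.Hom.op k) x) hc).trans (map_op_map_op ψ g₂ i₂ x).symm)
    obtain ⟨z, hz, hu⟩ := hF _ hS a ha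
    refine ⟨z, fun Y i t ht => ?_, fun z' hz' => hu z' fun Y i hi => ?_⟩
    · have hi : Presheaf.imageSieve f x i := ⟨t, ht⟩
      refine (hz i hi).trans (hg ?_)
      rw [Presheaf.app_localPreimage, ht]
    · exact hz' Y i _ (Presheaf.app_localPreimage f x i hi)
  choose z hz hu using key
  have hzf (X : Cᵒᵖ) (t : φ.obj X) : z X (f.app X t) = g.app X t := by
    have := hz X (f.app X t) X.unop (𝟙 _) t (by rw [op_id]; exact (ψ.map_id_apply _ _).symm)
    rw [op_id] at this
    exact (F.map_id_apply _ _).symm.trans this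
  refine ⟨{ app := fun X => TypeCat.ofHom (z X), naturality := ?_ }, ?_, ?_⟩
  · intro X Y k
    ext x
    refine (hu Y (ψ.map k x) (F.map k (z X x)) fun W i t ht => ?_).symm
    have h₁ := hz X x W (i ≫ k.unop) t (by
      rw [ht]
      exact map_op_map_op ψ i k.unop x)
    rw [← h₁]
    exact map_op_map_op F i k.unop _
  · ext X t
    exact hzf X t
  · intro h hh
    ext X x
    refine hu X x _ fun W i t ht => ?_
    change F.map i.op (h.app X x) = _
    rw [← NatTrans.naturality_apply, ← ht, ← hh]
    rfl

theorem iInf_mem_canonicalTopology {X : C} {ι : Type*} [Finite ι] (S : ι → Sieve X)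
    (hS : ∀ i, S i ∈ Sheaf.canonicalTopology C X) : ⨅ i, S i ∈ Sheaf.canonicalTopology C X := by
  have := Fintype.ofFinite ι
  rw [← Finset.inf_univ_eq_iInf]
  exact Finset.inf_induction (p := fun T => T ∈ Sheaf.canonicalTopology C X)
    (GrothendieckTopology.top_mem _ _)
    (fun _ h₁ _ h₂ => GrothendieckTopology.intersection_covering _ h₁ h₂) fun i _ => hS i

/-- Locally bijective morphisms are closed under finite limits: finitely many covering sieves have a
covering intersection, on which compatible local lifts can be chosen. -/
theorem IsBidense.of_isLimit {J : Type} [SmallCategory J] [FinCategory J]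
    {F G : J ⥤ Cᵒᵖ ⥤ Type v} (f : F ⟶ G) (hf : ∀ j, IsBidense (f.app j)) {s : Cone F}
    {t : Cone G} (hs : IsLimit s) (ht : IsLimit t) (m : s.pt ⟶ t.pt)
    (hm : ∀ j, m ≫ t.π.app j = s.π.app j ≫ f.app j) : IsBidense m := by
  have (j : J) := (hf j).1
  have (j : J) := (hf j).2
  have hm' (j : J) {X : Cᵒᵖ} (x : s.pt.obj X) :
      (t.π.app j).app X (m.app X x) = (f.app j).app X ((s.π.app j).app X x) :=
    ConcreteCategory.congr_hom (NatTrans.congr_app (hm j) X) x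
  have hw {X : Cᵒᵖ} {j j' : J} (g : j ⟶ j') (z : t.pt.obj X) :
      (G.map g).app X ((t.π.app j).app X z) = (t.π.app j').app X z :=
    ConcreteCategory.congr_hom (NatTrans.congr_app (t.w g) X) z
  have hws {X : Cᵒᵖ} {j j' : J} (g : j ⟶ j') (z : s.pt.obj X) :
      (F.map g).app X ((s.π.app j).app X z) = (s.π.app j').app X z :=
    ConcreteCategory.congr_hom (NatTrans.congr_app (s.w g) X) z
  have hf' {X : Cᵒᵖ} {j j' : J} (g : j ⟶ j') (x : (F.obj j).obj X) :
      (f.app j').app X ((F.map g).app X x) = (G.map g).app X ((f.app j).app X x) :=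
    ConcreteCategory.congr_hom (NatTrans.congr_app (f.naturality g) X) x
  constructor
  · constructor
    intro X z
    let S : Sieve X := ⨅ j, Presheaf.imageSieve (f.app j) ((t.π.app j).app _ z)
    have hS : S ∈ Sheaf.canonicalTopology C X := iInf_mem_canonicalTopology _ fun j =>
      Presheaf.imageSieve_mem _ (f.app j) _
    refine GrothendieckTopology.transitive _ hS _ fun Y i hi => ?_
    have hi' (j : J) : Presheaf.imageSieve (f.app j) ((t.π.app j).app _ z) i :=
      (iInf_le _ j : S ≤ _) _ hi
    choose x hx using hi'
    -- The local lifts `x j` are compatible only up to `f`, hence after a further refinement.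
    let T : Sieve Y := ⨅ g : (Σ p : J × J, p.1 ⟶ p.2),
      Presheaf.equalizerSieve (F := F.obj g.1.2) (X := op Y) ((F.map g.2).app _ (x g.1.1)) (x g.1.2)
    have hT : T ∈ Sheaf.canonicalTopology C Y := iInf_mem_canonicalTopology _ fun g => by
      refine Presheaf.equalizerSieve_mem _ (f.app g.1.2) (X := op Y) _ _ ?_
      rw [hf' g.2, hx, hx, NatTrans.naturality_apply]
      exact congrArg _ (hw g.2 z)
    refine GrothendieckTopology.superset_covering _ ?_ hT
    intro Z k hk
    obtain ⟨y, hy, -⟩ := existsUnique_of_isLimit hs (op Z) (fun j => (F.obj j).map k.op (x j))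
      (fun j j' g => by
        have h₁ := (iInf_le _ ⟨(j, j'), g⟩ : T ≤ _) _ hk
        exact (NatTrans.naturality_apply _ _ _).trans h₁)
    refine ⟨y, (existsUnique_of_isLimit ht (op Z) (fun j => (t.π.app j).app _ (t.pt.map
      (k ≫ i).op z)) (fun j j' g => hw g _)).unique (fun j => ?_) fun j => rfl⟩
    rw [hm', hy, NatTrans.naturality_apply, hx]
    exact (map_op_map_op _ _ _ _).trans (NatTrans.naturality_apply (t.π.app j) _ z).symm
  · constructor
    intro X x y hxy
    let S (j : J) : Sieve X.unop := Presheaf.equalizerSieve (F := F.obj j)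
      ((s.π.app j).app X x) ((s.π.app j).app X y)
    refine GrothendieckTopology.superset_covering _ ?_ (iInf_mem_canonicalTopology S fun j =>
      Presheaf.equalizerSieve_mem _ (f.app j) _ _ (by rw [← hm', ← hm', hxy]))
    intro Y k hk
    refine (existsUnique_of_isLimit hs (op Y) (fun j => (s.π.app j).app _ (s.pt.map k.op x))
      (fun j j' g => hws g _)).unique (fun j => rfl) fun j => ?_
    have h₁ := iInf_le S j _ hk
    exact (NatTrans.naturality_apply (s.π.app j) _ y).trans
      (h₁.symm.trans (NatTrans.naturality_apply (s.π.app j) _ x).symm)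

/-- Locally bijective morphisms are closed under weighted colimits. -/
theorem IsBidense.of_isPointwise {K : Type v} [SmallCategory K] {φ : Kᵒᵖ ⥤ Type v}
    {D D' : K ⥤ Cᵒᵖ ⥤ Type v} (a : D ⟶ D') (ha : ∀ k, IsBidense (a.app k))
    {ψ ψ' : Cᵒᵖ ⥤ Type v} {γ : WeightedCocone φ D ψ} {γ' : WeightedCocone φ D' ψ'}
    (hγ : γ.IsPointwise) (hγ' : γ'.IsPointwise) (m : ψ ⟶ ψ')
    (hm : ∀ k p, γ.app k p ≫ m = a.app k ≫ γ'.app k p) : IsBidense m := by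
  have (k : K) := (ha k).1
  have (k : K) := (ha k).2
  have hm' {X : Cᵒᵖ} (k : K) (p : φ.obj (op k)) (d : (D.obj k).obj X) :
      m.app X ((γ.app k p).app X d) = (γ'.app k p).app X ((a.app k).app X d) :=
    ConcreteCategory.congr_hom (NatTrans.congr_app (hm k p) X) d
  have ha' {X : Cᵒᵖ} {k k' : K} (g : k ⟶ k') (x : (D.obj k).obj X) :
      (a.app k').app X ((D.map g).app X x) = (D'.map g).app X ((a.app k).app X x) :=
    ConcreteCategory.congr_hom (NatTrans.congr_app (a.naturality g) X) x
  constructor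
  · constructor
    intro X x
    obtain ⟨k, p, d, rfl⟩ := hγ'.exists_rep _ x
    refine GrothendieckTopology.superset_covering _ ?_ (Presheaf.imageSieve_mem _ (a.app k) d)
    rintro Y i ⟨y, hy⟩
    refine ⟨(γ.app k p).app _ y, ?_⟩
    rw [hm', hy, NatTrans.naturality_apply]
  · -- Along a chain of elementary identifications in `ψ'`, any lifts are locally identified in `ψ`.
    have key {X : Cᵒᵖ} (t t' : Σ k : K, φ.obj (op k) × (D'.obj k).obj X)
        (h : Relation.EqvGen (WeightedRel φ D' X) t t') :
        ∀ ⦃Y : Cᵒᵖ⦄ (i : X ⟶ Y) (d : (D.obj t.1).obj Y) (d' : (D.obj t'.1).obj Y),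
          (a.app t.1).app Y d = (D'.obj t.1).map i t.2.2 →
          (a.app t'.1).app Y d' = (D'.obj t'.1).map i t'.2.2 →
          Presheaf.equalizerSieve (F := ψ) ((γ.app t.1 t.2.1).app Y d)
              ((γ.app t'.1 t'.2.1).app Y d') ∈
            Sheaf.canonicalTopology C Y.unop := by
      have hloc {Y : Cᵒᵖ} (k : K) (p : φ.obj (op k)) (d d' : (D.obj k).obj Y)
          (h : (a.app k).app Y d = (a.app k).app Y d') :
          Presheaf.equalizerSieve (F := ψ) ((γ.app k p).app Y d) ((γ.app k p).app Y d') ∈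
            Sheaf.canonicalTopology C Y.unop := by
        refine GrothendieckTopology.superset_covering _ ?_
          (Presheaf.equalizerSieve_mem _ (a.app k) d d' h)
        intro Z j hj
        change ψ.map j.op _ = ψ.map j.op _
        rw [← NatTrans.naturality_apply, ← NatTrans.naturality_apply]
        exact congrArg _ hj
      induction h with
      | rel t t' h =>
        obtain ⟨g, h₁, h₂⟩ := h
        intro Y i d d' hd hd'
        rw [h₁, γ.naturality_app]
        exact hloc _ _ _ _ (by rw [ha', hd, hd', h₂, NatTrans.naturality_apply])
      | refl t =>
        intro Y i d d' hd hd'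
        exact hloc _ _ _ _ (hd.trans hd'.symm)
      | symm t t' _ ih =>
        intro Y i d d' hd hd'
        refine GrothendieckTopology.superset_covering _ ?_ (ih i d' d hd' hd)
        intro Z j hj
        exact Eq.symm hj
      | trans t t' t'' _ _ ih₁ ih₂ =>
        intro Y i d d'' hd hd''
        refine GrothendieckTopology.transitive _ (Presheaf.imageSieve_mem _ (a.app t'.1)
          ((D'.obj t'.1).map i t'.2.2)) _ ?_
        rintro Z j ⟨d', hd'⟩
        have hr (t : Σ k : K, φ.obj (op k) × (D'.obj k).obj X) (d : (D.obj t.1).obj Y)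
            (hd : (a.app t.1).app Y d = (D'.obj t.1).map i t.2.2) :
            (a.app t.1).app (op Z) ((D.obj t.1).map j.op d) =
              (D'.obj t.1).map (i ≫ j.op) t.2.2 := by
          rw [NatTrans.naturality_apply, hd, Functor.map_comp_apply]
        have h₁ := ih₁ (i ≫ j.op) _ d' (hr t d hd) (by rw [hd', Functor.map_comp_apply])
        have h₂ := ih₂ (i ≫ j.op) d' _ (by rw [hd', Functor.map_comp_apply]) (hr t'' d'' hd'')
        refine GrothendieckTopology.superset_covering _ ?_
          (GrothendieckTopology.intersection_covering _ h₁ h₂)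
        rintro W l ⟨hl₁, hl₂⟩
        have hl := hl₁.trans hl₂
        rw [NatTrans.naturality_apply, NatTrans.naturality_apply] at hl
        exact (map_op_map_op ψ l j _).symm.trans (hl.trans (map_op_map_op ψ l j _))
    constructor
    intro X x y hxy
    obtain ⟨k, p, d, rfl⟩ := hγ.exists_rep _ x
    obtain ⟨k', p', d', rfl⟩ := hγ.exists_rep _ y
    rw [hm', hm'] at hxy
    exact key ⟨k, p, (a.app k).app _ d⟩ ⟨k', p', (a.app k').app _ d'⟩ (hγ'.eqvGen _ _ _ hxy) (𝟙 _)
      d d' (Functor.map_id_apply (D'.obj k) X _).symm (Functor.map_id_apply (D'.obj k') X _).symm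

end

/-! ### Postulated morphisms are the bidense ones -/

section

variable {C : Type u} [Category.{v} C]

theorem IsBidense.isFinalMor {φ ψ : SmallPsh C} {f : φ ⟶ ψ} (hf : IsBidense f.hom) :
    IsFinalMor f := by
  intro X g
  obtain ⟨h, hh, hu⟩ := hf.existsUnique_extension (Sheaf.isSheaf_yoneda_obj X) g.hom
  exact ⟨ObjectProperty.homMk h, ObjectProperty.hom_ext _ hh, fun h' hh' =>
    ObjectProperty.hom_ext _ (hu _ (congrArg InducedCategory.Hom.hom hh'))⟩

theorem IsBidense.of_isPullback {φ ψ φ' ψ' : SmallPsh C} {f : φ ⟶ ψ} (hf : IsBidense f.hom)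
    {g' : φ' ⟶ φ} {f' : φ' ⟶ ψ'} {g : ψ' ⟶ ψ} (h : IsPullback g' f' f g) : IsBidense f'.hom := by
  have := hf.1; have := hf.2
  have hw {X : Cᵒᵖ} (x : φ'.obj.obj X) :
      f.hom.app X (g'.hom.app X x) = g.hom.app X (f'.hom.app X x) :=
    ConcreteCategory.congr_hom (NatTrans.congr_app (congrArg InducedCategory.Hom.hom h.w) X) x
  constructor
  · constructor
    intro X x
    refine GrothendieckTopology.superset_covering _ ?_
      (Presheaf.imageSieve_mem _ f.hom (g.hom.app _ x))
    rintro Y i ⟨y, hy⟩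
    obtain ⟨z, -, hz⟩ := isPullback_exists h (a := y) (b := ψ'.obj.map i.op x)
      (by rw [hy, NatTrans.naturality_apply])
    exact ⟨z, hz⟩
  · constructor
    intro X x y hxy
    refine GrothendieckTopology.superset_covering _ ?_
      (Presheaf.equalizerSieve_mem _ f.hom (g'.hom.app _ x) (g'.hom.app _ y)
        (by rw [hw, hw, hxy]))
    intro Y i hi
    refine isPullback_ext h ?_ ?_
    · rw [NatTrans.naturality_apply, NatTrans.naturality_apply]
      exact hi
    · rw [NatTrans.naturality_apply, NatTrans.naturality_apply, hxy]

theorem IsBidense.isStablyFinal {φ ψ : SmallPsh C} {f : φ ⟶ ψ} (hf : IsBidense f.hom) :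
    IsStablyFinal f :=
  fun _ _ _ _ _ h => (hf.of_isPullback h).isFinalMor

/-- If the pullback of `f` along an element of `ψ` is final, then the representables satisfy the
sheaf condition for the sieve on which that element lifts along `f`. -/
theorem isSheafFor_imageSieve {φ ψ π : SmallPsh C} {X : C} {f : φ ⟶ ψ} {p : π ⟶ φ}
    {q : π ⟶ (smallYoneda C).obj X} {g : (smallYoneda C).obj X ⟶ ψ} (h : IsPullback p q f g)
    (hq : IsFinalMor q) (Z : C) : Presieve.IsSheafFor (yoneda.obj Z)
      (Presheaf.imageSieve f.hom (smallYonedaEquiv g)).arrows := by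
  intro x hx
  have hg {Y : C} (i : Y ⟶ X) : g.hom.app (op Y) i = ψ.obj.map i.op (smallYonedaEquiv g) :=
    (map_yonedaEquiv g.hom i).symm
  have hw {Y : C} (w : π.obj.obj (op Y)) :
      f.hom.app _ (p.hom.app _ w) = ψ.obj.map (Quiver.Hom.op (X := Y) (Y := X) (q.hom.app _ w))
        (smallYonedaEquiv g) :=
    (ConcreteCategory.congr_hom
      (NatTrans.congr_app (congrArg InducedCategory.Hom.hom h.w) (op Y)) w).trans (hg _)
  -- A compatible family on the sieve is a morphism out of the pullback.
  let a : π ⟶ (smallYoneda C).obj Z := ObjectProperty.homMk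
    { app := fun Y => TypeCat.ofHom fun w => x (Y := Y.unop) (q.hom.app Y w) ⟨p.hom.app Y w, hw w⟩
      naturality := fun Y Y' k => by
        ext w
        have hk : (q.hom.app Y' (π.obj.map k w) : Y'.unop ⟶ X) =
            k.unop ≫ (q.hom.app Y w : Y.unop ⟶ X) :=
          NatTrans.naturality_apply q.hom k w
        have := hx (𝟙 Y'.unop) k.unop ⟨p.hom.app Y' (π.obj.map k w), hw _⟩
          ⟨p.hom.app Y w, hw w⟩ ((Category.id_comp _).trans hk)
        exact (Category.id_comp _).symm.trans this }
  have ha {Y : C} {i : Y ⟶ X} (hi : Presheaf.imageSieve f.hom (smallYonedaEquiv g) i) :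
      ∃ w : π.obj.obj (op Y), q.hom.app _ w = i ∧ a.hom.app _ w = x i hi := by
    obtain ⟨t, ht⟩ := hi
    obtain ⟨w, hw₁, hw₂⟩ := isPullback_exists h (a := t) (b := i) (ht.trans (hg i).symm)
    refine ⟨w, hw₂, ?_⟩
    subst hw₂
    rfl
  obtain ⟨e, he, hu⟩ := hq Z a
  have he' (b : (smallYoneda C).obj X ⟶ (smallYoneda C).obj Z) {Y : C} (i : Y ⟶ X) :
      b.hom.app (op Y) i = (yoneda.obj Z).map i.op (smallYonedaEquiv b) :=
    (map_yonedaEquiv b.hom i).symm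
  refine ⟨smallYonedaEquiv e, fun Y i hi => ?_, fun z hz => ?_⟩
  · obtain ⟨w, hw₁, hw₂⟩ := ha hi
    rw [← hw₂, ← he' e, ← hw₁, ← he]
    rfl
  · let b : (smallYoneda C).obj X ⟶ (smallYoneda C).obj Z := smallYonedaEquiv.symm z
    have hb : b = e := hu _ (smallPsh_hom_ext fun Y w =>
      hz (Y := Y) (q.hom.app _ w) ⟨p.hom.app _ w, hw w⟩)
    exact (smallYonedaEquiv.apply_symm_apply _).symm.trans (congrArg smallYonedaEquiv hb)

/-- Pullbacks along all representables give sheaf conditions that are stable under base change, and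
these characterize the covering sieves of the canonical topology. -/
theorem isLocallySurjective_of_pullbacks {φ ψ : SmallPsh C} (f : φ ⟶ ψ)
    (h : ∀ (X : C) (g : (smallYoneda C).obj X ⟶ ψ), ∃ (π : SmallPsh C) (p : π ⟶ φ)
      (q : π ⟶ (smallYoneda C).obj X), IsPullback p q f g ∧ IsFinalMor q) :
    Presheaf.IsLocallySurjective (Sheaf.canonicalTopology C) f.hom where
  imageSieve_mem {X} x := by
    refine Sheaf.mem_finestTopology_of_forall_isSheafFor ?_
    rintro _ ⟨Z, rfl⟩ Y i
    rw [Presheaf.pullback_imageSieve]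
    obtain ⟨π, p, q, hpq, hq⟩ := h Y (smallYonedaEquiv.symm (ψ.obj.map i.op x))
    have := isSheafFor_imageSieve hpq hq Z
    rwa [Equiv.apply_symm_apply] at this

/-- An element of the kernel pair is a pair of identified elements, and it lifts along the diagonal
exactly where the two agree. -/
theorem isLocallyInjective_iff_diagonal {φ ψ κ : SmallPsh C} {f : φ ⟶ ψ} {p q : κ ⟶ φ}
    (h : IsPullback p q f f) :
    Presheaf.IsLocallyInjective (Sheaf.canonicalTopology C) f.hom ↔
      Presheaf.IsLocallySurjective (Sheaf.canonicalTopology C)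
        (h.lift (𝟙 φ) (𝟙 φ) rfl).hom := by
  have hp {X : Cᵒᵖ} (t : φ.obj.obj X) : p.hom.app X ((h.lift (𝟙 φ) (𝟙 φ) rfl).hom.app X t) = t :=
    ConcreteCategory.congr_hom (NatTrans.congr_app (congrArg InducedCategory.Hom.hom
      (h.lift_fst (𝟙 φ) (𝟙 φ) rfl)) X) t
  have hq {X : Cᵒᵖ} (t : φ.obj.obj X) : q.hom.app X ((h.lift (𝟙 φ) (𝟙 φ) rfl).hom.app X t) = t :=
    ConcreteCategory.congr_hom (NatTrans.congr_app (congrArg InducedCategory.Hom.hom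
      (h.lift_snd (𝟙 φ) (𝟙 φ) rfl)) X) t
  have hw {X : Cᵒᵖ} (x : κ.obj.obj X) :
      f.hom.app X (p.hom.app X x) = f.hom.app X (q.hom.app X x) :=
    ConcreteCategory.congr_hom (NatTrans.congr_app (congrArg InducedCategory.Hom.hom h.w) X) x
  constructor
  · intro hf
    constructor
    intro X x
    refine GrothendieckTopology.superset_covering _ ?_ (Presheaf.equalizerSieve_mem _ f.hom _ _
      (hw x))
    intro Y i hi
    refine ⟨φ.obj.map i.op (p.hom.app _ x), isPullback_ext h ?_ ?_⟩
    · rw [hp, NatTrans.naturality_apply]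
    · rw [hq, NatTrans.naturality_apply]
      exact hi
  · intro hδ
    constructor
    intro X a b hab
    obtain ⟨x, hx₁, hx₂⟩ := isPullback_exists h hab
    refine GrothendieckTopology.superset_covering _ ?_ (Presheaf.imageSieve_mem _
      (h.lift (𝟙 φ) (𝟙 φ) rfl).hom x)
    rintro Y i ⟨t, ht⟩
    change φ.obj.map i.op a = φ.obj.map i.op b
    rw [← hx₁, ← hx₂, ← NatTrans.naturality_apply, ← NatTrans.naturality_apply]
    have h₁ := congrArg (p.hom.app _) ht
    have h₂ := congrArg (q.hom.app _) ht
    rw [hp] at h₁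
    rw [hq] at h₂
    exact h₁.symm.trans h₂

variable [HasFiniteLimits C]

theorem IsStablyFinal.isLocallySurjective {φ ψ : SmallPsh C} {f : φ ⟶ ψ} (hf : IsStablyFinal f) :
    Presheaf.IsLocallySurjective (Sheaf.canonicalTopology C) f.hom :=
  isLocallySurjective_of_pullbacks f fun _ g =>
    ⟨_, _, _, IsPullback.of_hasPullback f g, hf _ _ _ (IsPullback.of_hasPullback f g)⟩

theorem isSmallPresheaf_range {φ ψ : SmallPsh C} (f : φ ⟶ ψ) :
    IsSmallPresheaf (Subfunctor.range f.hom).toFunctor := by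
  obtain ⟨P, hP, hs⟩ := exists_smallOn_family (fun i : Fin 2 => ![φ.obj, ψ.obj] i)
    (fun i => by fin_cases i; exacts [φ.property, ψ.property])
  have hφ : SmallOn P φ.obj := hs 0
  have hψ : SmallOn P ψ.obj := hs 1
  refine SmallOn.isSmallPresheaf hP ⟨?_, ?_⟩
  · rintro X ⟨_, x, rfl⟩
    obtain ⟨A, hA, i, y, rfl⟩ := hφ.exists_factor X x
    refine ⟨A, hA, i, ⟨_, y, rfl⟩, Subtype.ext ?_⟩
    exact (NatTrans.naturality_apply f.hom i.op y).symm
  · intro X A A' hA hA' i i' y y' h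
    obtain ⟨B, hB, e, k, k', hk, hk', hy⟩ := hψ.exists_eq hA hA' i i' y.1 y'.1
      (congrArg Subtype.val h)
    exact ⟨B, hB, e, k, k', hk, hk', Subtype.ext hy⟩

/-- The image of a morphism of `𝒫 C`, computed objectwise. -/
@[simps]
def imageFactorisation {φ ψ : SmallPsh C} (f : φ ⟶ ψ) : MonoFactorisation f where
  I := ⟨_, isSmallPresheaf_range f⟩
  m := ObjectProperty.homMk (Subfunctor.range f.hom).ι
  m_mono := mono_of_injective _ fun _ _ _ h => Subtype.ext h
  e := ObjectProperty.homMk (Subfunctor.toRange f.hom)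
  fac := rfl

theorem nonempty_isImage {φ ψ : SmallPsh C} (f : φ ⟶ ψ) :
    Nonempty (IsImage (imageFactorisation f)) := by
  have key (F : MonoFactorisation f) : ∃ l : (imageFactorisation f).I ⟶ F.I,
      l ≫ F.m = (imageFactorisation f).m := by
    have hF {X : Cᵒᵖ} (t : φ.obj.obj X) : F.m.hom.app X (F.e.hom.app X t) = f.hom.app X t :=
      ConcreteCategory.congr_hom (NatTrans.congr_app (congrArg InducedCategory.Hom.hom F.fac) X) t
    choose t ht using fun (X : Cᵒᵖ) (y : (Subfunctor.range f.hom).toFunctor.obj X) => y.2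
    let l : (Subfunctor.range f.hom).toFunctor ⟶ F.I.obj :=
      { app := fun X => TypeCat.ofHom fun y => F.e.hom.app X (t X y)
        naturality := fun X Y k => by
          ext y
          apply injective_of_mono F.m
          refine (hF _).trans ((ht Y _).trans ?_)
          exact ((NatTrans.naturality_apply F.m.hom k (F.e.hom.app X (t X y))).trans
            (congrArg (ψ.obj.map k) ((hF _).trans (ht X y)))).symm }
    refine ⟨ObjectProperty.homMk l, smallPsh_hom_ext fun X y => ?_⟩
    exact (hF _).trans (ht _ y)
  choose l hl using key
  exact ⟨⟨l, hl⟩⟩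

/-- Being postulated is local bijectivity for the canonical topology: a stably final monomorphism is
one along which every element of the codomain lifts on a sieve that is stably effective for the
representables, and the image and the diagonal express local surjectivity and local injectivity. -/
theorem isPostulated_iff_isBidense {φ ψ : SmallPsh C} {f : φ ⟶ ψ} :
    IsPostulated f ↔ IsBidense f.hom := by
  constructor
  · rintro ⟨⟨F, ⟨hF⟩, hm⟩, κ, p, q, h, hδ⟩
    refine ⟨⟨fun {X} x => ?_⟩, (isLocallyInjective_iff_diagonal h).2 hδ.isLocallySurjective⟩
    have := hm.isLocallySurjective
    refine GrothendieckTopology.superset_covering _ ?_ (Presheaf.imageSieve_mem _ F.m.hom x)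
    rintro Y i ⟨t, ht⟩
    obtain ⟨s, hs⟩ := ((hF.lift (imageFactorisation f)).hom.app _ t).2
    refine ⟨s, hs.trans (Eq.trans ?_ ht)⟩
    exact ConcreteCategory.congr_hom (NatTrans.congr_app (congrArg InducedCategory.Hom.hom
      (hF.lift_fac (imageFactorisation f))) _) t
  · intro hf
    have := hf.1
    have := hf.2
    refine ⟨⟨imageFactorisation f, nonempty_isImage f, IsBidense.isStablyFinal ⟨⟨?_⟩, ?_⟩⟩, _, _, _,
      IsPullback.of_hasPullback f f, IsBidense.isStablyFinal ⟨?_, ?_⟩⟩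
    · intro X x
      refine GrothendieckTopology.superset_covering _ ?_ (Presheaf.imageSieve_mem _ f.hom x)
      rintro Y i ⟨t, ht⟩
      exact ⟨⟨_, t, rfl⟩, ht⟩
    · exact Presheaf.isLocallyInjective_of_injective _ _ (injective_of_mono _)
    · exact (isLocallyInjective_iff_diagonal _).1 hf.2
    · have : Mono ((IsPullback.of_hasPullback f f).lift (𝟙 φ) (𝟙 φ) rfl) :=
        mono_of_mono_fac ((IsPullback.of_hasPullback f f).lift_fst (𝟙 φ) (𝟙 φ) rfl)
      exact Presheaf.isLocallyInjective_of_injective _ _ (injective_of_mono _)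

end

/-! ### Lex-colimit morphisms in an exact category -/

section

variable {C : Type u} [Category.{v} C]

/-- The inclusion into `𝒫 C` of a full subcategory that contains the representables preserves all
limits. -/
theorem preservesLimitsOfShape_ι {Q : ObjectProperty (SmallPsh C)}
    (hQ : ∀ X, Q ((smallYoneda C).obj X)) (J : Type*) [Category* J] :
    PreservesLimitsOfShape J Q.ι := by
  have : PreservesLimitsOfShape J (Q.ι ⋙ IsSmallPresheaf.ι) :=
    preservesLimitsOfShape_of_representables _
      (fun X => ⟨⟨(smallYoneda C).obj X, hQ X⟩, ⟨Iso.refl _⟩⟩) J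
  exact preservesLimitsOfShape_of_reflects_of_preserves Q.ι IsSmallPresheaf.ι

/-- The weighted cocone in `𝒫 C` that corresponds to a transformation `α` into a small
presheaf. -/
def smallCoconeOfLan {K : Type v} [SmallCategory K] {φ : Kᵒᵖ ⥤ Type v} {D : K ⥤ C} {ψ : SmallPsh C}
    (α : φ ⟶ D.op ⋙ ψ.obj) : WeightedCocone φ (D ⋙ smallYoneda C) ψ where
  app k p := smallYonedaEquiv.symm (α.app (op k) p)
  naturality _ _ g p := ObjectProperty.hom_ext _ ((coconeOfLan α).naturality g p)

theorem smallCoconeOfLan_isPointwise {K : Type v} [SmallCategory K] {φ : Kᵒᵖ ⥤ Type v}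
    {D : K ⥤ C} {ψ : SmallPsh C} {α : φ ⟶ D.op ⋙ ψ.obj}
    (h : (Functor.LeftExtension.mk (L := D.op) ψ.obj α).IsPointwiseLeftKanExtension) :
    ((smallCoconeOfLan α).map IsSmallPresheaf.ι).IsPointwise :=
  coconeOfLan_isPointwise h

variable {Φ : LexWeightClass.{v}}

theorem lexClosure_of_lan {K : Type v} [SmallCategory K] [HasFiniteLimits K] {φ : Kᵒᵖ ⥤ Type v}
    (hφ : φ ∈ Φ K) {D : K ⥤ C} [PreservesFiniteLimits D] {ψ : SmallPsh C} {α : φ ⟶ D.op ⋙ ψ.obj}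
    (h : (Functor.LeftExtension.mk (L := D.op) ψ.obj α).IsPointwiseLeftKanExtension) :
    LexClosure Φ ψ := by
  have : PreservesFiniteLimits (smallYoneda C) := ⟨fun J _ _ => inferInstance⟩
  exact .lexColimit K φ hφ (D ⋙ smallYoneda C) (fun _ => .representable _) ψ (smallCoconeOfLan α)
    (WeightedCocone.isColimit_of_isPointwise (smallCoconeOfLan_isPointwise h))

/-- Any left adjoint of `W` inverts exactly the final morphisms, by adjunction and Yoneda. -/
theorem isIso_map_iff_isFinalMor {L : LexCompletion Φ C ⥤ C} (adj : L ⊣ lexCompletionUnit Φ C)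
    {a b : LexCompletion Φ C} (q : a ⟶ b) : IsIso (L.map q) ↔ IsFinalMor q.hom := by
  constructor
  · intro _ X g
    let g' : a ⟶ (lexCompletionUnit Φ C).obj X := ObjectProperty.homMk g
    have key (h : b ⟶ (lexCompletionUnit Φ C).obj X) :
        q ≫ h = g' ↔ h = adj.homEquiv _ _ (inv (L.map q) ≫ (adj.homEquiv _ _).symm g') := by
      rw [← (adj.homEquiv _ _).symm.injective.eq_iff, adj.homEquiv_naturality_left_symm,
        ← (adj.homEquiv _ _).symm.injective.eq_iff (a := h), Equiv.symm_apply_apply,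
        IsIso.eq_inv_comp]
    refine ⟨_, congrArg InducedCategory.Hom.hom ((key _).2 rfl), fun h hh => ?_⟩
    exact congrArg InducedCategory.Hom.hom
      ((key (ObjectProperty.homMk h)).1 (ObjectProperty.hom_ext _ hh))
  · intro hq
    refine isIso_of_coyoneda_map_bijective _ fun X => ?_
    refine (Function.bijective_iff_existsUnique _).2 fun g => ?_
    obtain ⟨h, hh, hu⟩ := hq X (adj.homEquiv _ _ g).hom
    let h' : b ⟶ (lexCompletionUnit Φ C).obj X := ObjectProperty.homMk h
    have key (x : L.obj b ⟶ X) : L.map q ≫ x = g ↔ q ≫ adj.homEquiv _ _ x = adj.homEquiv _ _ g := by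
      rw [← adj.homEquiv_naturality_left, (adj.homEquiv _ _).injective.eq_iff]
    refine ⟨(adj.homEquiv _ _).symm h', (key _).2 ?_, fun x hx => ?_⟩
    · rw [Equiv.apply_symm_apply]
      exact ObjectProperty.hom_ext _ hh
    · rw [Equiv.eq_symm_apply]
      exact ObjectProperty.hom_ext _ (hu _ (congrArg InducedCategory.Hom.hom ((key x).1 hx)))

theorem LexClosure.of_isPullback {φ χ ψ π : SmallPsh C} {p : π ⟶ φ} {q : π ⟶ χ} {f : φ ⟶ ψ}
    {g : χ ⟶ ψ} (h : IsPullback p q f g) (hφ : LexClosure Φ φ) (hχ : LexClosure Φ χ)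
    (hψ : LexClosure Φ ψ) : LexClosure Φ π :=
  .finiteLimit WalkingCospan (cospan f g) (by rintro (_ | _ | _) <;> assumption) h.cone h.isLimit

theorem LexClosure.of_iso {φ ψ : SmallPsh C} (e : φ ≅ ψ) (h : LexClosure Φ ψ) : LexClosure Φ φ :=
  .of_isPullback (IsPullback.of_vert_isIso ⟨rfl⟩ : IsPullback e.hom e.hom (𝟙 ψ) (𝟙 ψ)) h h h

theorem isPullback_lexCompletion {a b c d : LexCompletion Φ C} {p : a ⟶ b} {q : a ⟶ c} {f : b ⟶ d}
    {g : c ⟶ d} (h : IsPullback p.hom q.hom f.hom g.hom) : IsPullback p q f g :=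
  IsPullback.of_map (LexClosure Φ (C := C)).ι (ObjectProperty.hom_ext _ h.w) h

variable [HasFiniteLimits C]

/-- Since a lex reflection inverts all pullbacks of a morphism that it inverts, such a morphism is
locally surjective. -/
theorem isLocallySurjective_of_isIso_map {L : LexCompletion Φ C ⥤ C}
    (adj : L ⊣ lexCompletionUnit Φ C) [PreservesFiniteLimits L] {a b : LexCompletion Φ C}
    (f : a ⟶ b) [IsIso (L.map f)] :
    Presheaf.IsLocallySurjective (Sheaf.canonicalTopology C) f.hom.hom := by
  refine isLocallySurjective_of_pullbacks f.hom fun X g => ?_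
  have h := IsPullback.of_hasPullback f.hom g
  let π : LexCompletion Φ C :=
    ⟨_, LexClosure.of_isPullback h a.property (.representable X) b.property⟩
  let p : π ⟶ a := ObjectProperty.homMk (pullback.fst f.hom g)
  let q : π ⟶ (lexCompletionUnit Φ C).obj X := ObjectProperty.homMk (pullback.snd f.hom g)
  let g' : (lexCompletionUnit Φ C).obj X ⟶ b := ObjectProperty.homMk g
  have h' : IsPullback p q f g' := isPullback_lexCompletion h
  have := (h'.map L).isIso_snd_of_isIso
  exact ⟨_, _, _, h, (isIso_map_iff_isFinalMor adj q).1 this⟩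

theorem isBidense_of_isIso_map {L : LexCompletion Φ C ⥤ C}
    (adj : L ⊣ lexCompletionUnit Φ C) [PreservesFiniteLimits L] {a b : LexCompletion Φ C}
    (f : a ⟶ b) [IsIso (L.map f)] : IsBidense f.hom.hom := by
  refine ⟨isLocallySurjective_of_isIso_map adj f, ?_⟩
  have h := IsPullback.of_hasPullback f.hom f.hom
  rw [isLocallyInjective_iff_diagonal h]
  let κ : LexCompletion Φ C := ⟨_, LexClosure.of_isPullback h a.property a.property b.property⟩
  let p : κ ⟶ a := ObjectProperty.homMk (pullback.fst f.hom f.hom)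
  let q : κ ⟶ a := ObjectProperty.homMk (pullback.snd f.hom f.hom)
  have h' : IsPullback p q f f := isPullback_lexCompletion h
  let δ : a ⟶ κ := ObjectProperty.homMk (h.lift (𝟙 _) (𝟙 _) rfl)
  have hδ : δ ≫ p = 𝟙 a := ObjectProperty.hom_ext _ (h.lift_fst _ _ _)
  have := (h'.map L).isIso_fst_of_isIso
  have : IsIso (L.map δ) := by
    have : IsIso (L.map δ ≫ L.map p) := by
      rw [← L.map_comp, hδ]
      infer_instance
    exact IsIso.of_isIso_comp_right _ (L.map p)
  exact isLocallySurjective_of_isIso_map adj δ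

/-- The domain of a `Φ`-lex-colimit morphism lies in `Φₗ C`, so that the lex reflection applies to
the morphism and, by finality, inverts it. -/
theorem lexColimitsPostulated_of_isExact (h : IsExact Φ C) : LexColimitsPostulated Φ C := by
  obtain ⟨-, L, ⟨adj⟩, hL⟩ := h
  rintro ψ c f ⟨K, _, _, φ, D, α, γ, hφ, hD, ⟨hα⟩, -, hf⟩
  rw [isPostulated_iff_isBidense]
  let a : LexCompletion Φ C := ⟨ψ, lexClosure_of_lan hφ hα⟩
  let f' : a ⟶ (lexCompletionUnit Φ C).obj c := ObjectProperty.homMk f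
  have : IsIso (L.map f') := (isIso_map_iff_isFinalMor adj f').2 hf
  exact isBidense_of_isIso_map adj f'

end

/-! ### Bidense reflections onto representables -/

section

variable (C : Type u) [Category.{v} C]

/-- The small presheaves that admit a bidense morphism to a representable. -/
def HasBidenseReflection : ObjectProperty (SmallPsh C) := fun φ =>
  ∃ (c : C) (f : φ ⟶ (smallYoneda C).obj c), IsBidense f.hom

variable {C}

theorem hasBidenseReflection_representable (X : C) :
    HasBidenseReflection C ((smallYoneda C).obj X) :=
  ⟨X, 𝟙 _, isBidense_of_isIso (𝟙 (yoneda.obj X))⟩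

variable (C)

/-- The Yoneda embedding into the presheaves with a bidense reflection. -/
def reflectionUnit : C ⥤ (HasBidenseReflection C).FullSubcategory :=
  ObjectProperty.lift _ (smallYoneda C) hasBidenseReflection_representable

/-- Bidense morphisms to representables are final, hence universal among morphisms to
representables. -/
theorem exists_bidenseReflector :
    ∃ (R : (HasBidenseReflection C).FullSubcategory ⥤ C) (adj : R ⊣ reflectionUnit C),
      ∀ a, IsBidense (adj.unit.app a).hom.hom := by
  choose R η hη using fun a : (HasBidenseReflection C).FullSubcategory => a.property
  let e (a : (HasBidenseReflection C).FullSubcategory) (X : C) :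
      (R a ⟶ X) ≃ (a ⟶ (reflectionUnit C).obj X) :=
    Equiv.ofBijective (fun h => ObjectProperty.homMk (η a ≫ (smallYoneda C).map h)) <| by
      refine (Function.bijective_iff_existsUnique _).2 fun g => ?_
      obtain ⟨h, hh, hu⟩ := (hη a).isFinalMor X g.hom
      obtain ⟨h, rfl⟩ := (smallYoneda C).map_surjective h
      refine ⟨h, ObjectProperty.hom_ext _ hh, fun h' hh' => (smallYoneda C).map_injective ?_⟩
      exact hu _ (congrArg InducedCategory.Hom.hom hh')
  have he (a : (HasBidenseReflection C).FullSubcategory) (X Y : C) (g : X ⟶ Y) (h : R a ⟶ X) :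
      e a Y (h ≫ g) = e a X h ≫ (reflectionUnit C).map g := by
    refine ObjectProperty.hom_ext _ ?_
    change η a ≫ (smallYoneda C).map (h ≫ g) = (η a ≫ (smallYoneda C).map h) ≫ (smallYoneda C).map g
    rw [Functor.map_comp, Category.assoc]
  refine ⟨_, Adjunction.adjunctionOfEquivLeft e he, fun a => ?_⟩
  have h₁ : (Adjunction.adjunctionOfEquivLeft e he).unit.app a = e a _ (𝟙 _) := by
    simp [Adjunction.adjunctionOfEquivLeft]
  have h₂ : (e a _ (𝟙 (R a))).hom = η a := by
    change η a ≫ (smallYoneda C).map (𝟙 (R a)) = η a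
    rw [CategoryTheory.Functor.map_id, Category.comp_id]
  rw [h₁]
  have h₃ := hη a
  rw [← h₂] at h₃
  exact h₃

variable {C}

theorem IsFinalMor.isIso {a b : C} {k : a ⟶ b} (hk : IsFinalMor ((smallYoneda C).map k)) :
    IsIso k := by
  obtain ⟨h, hh, -⟩ := hk a (𝟙 _)
  obtain ⟨h, rfl⟩ := (smallYoneda C).map_surjective h
  have h₁ : k ≫ h = 𝟙 a := (smallYoneda C).map_injective (by
    rw [Functor.map_comp, hh, CategoryTheory.Functor.map_id])
  refine ⟨h, h₁, (smallYoneda C).map_injective ?_⟩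
  refine (hk b ((smallYoneda C).map k)).unique ?_ ?_ <;> rw [← Functor.map_comp]
  · rw [reassoc_of% h₁]
  · rw [Category.comp_id]

section

variable {R : (HasBidenseReflection C).FullSubcategory ⥤ C} (adj : R ⊣ reflectionUnit C)
  (hadj : ∀ a, IsBidense (adj.unit.app a).hom.hom)

include hadj

/-- A finite limit of bidense reflections is bidense. -/
theorem isBidense_of_isLimit {J : Type} [SmallCategory J] [FinCategory J]
    (F : J ⥤ (HasBidenseReflection C).FullSubcategory)
    {t : Cone (F ⋙ (HasBidenseReflection C).ι)} (ht : IsLimit t) {l : Cone (F ⋙ R)}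
    (hl : IsLimit l) (m : t.pt ⟶ (smallYoneda C).obj l.pt)
    (hm : ∀ j, m ≫ (smallYoneda C).map (l.π.app j) = t.π.app j ≫ (adj.unit.app (F.obj j)).hom) :
    IsBidense m.hom := by
  let U := (HasBidenseReflection C).ι ⋙ IsSmallPresheaf.ι
  let f : F ⋙ U ⟶ (F ⋙ R) ⋙ yoneda := Functor.whiskerRight (Functor.whiskerLeft F adj.unit) U
  exact IsBidense.of_isLimit f (fun j => hadj (F.obj j))
    (isLimitOfPreserves IsSmallPresheaf.ι ht) (isLimitOfPreserves yoneda hl) m.hom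
    fun j => congrArg InducedCategory.Hom.hom (hm j)

/-- The comparison from the reflection of a limit to the limit of the reflections is a bidense
morphism between representables, hence an isomorphism. -/
theorem reflector_preservesFiniteLimits [HasFiniteLimits C] : PreservesFiniteLimits R := by
  refine ⟨fun J _ _ => ⟨fun {F} => ⟨fun {t} ht => ?_⟩⟩⟩
  have := preservesLimitsOfShape_ι (hasBidenseReflection_representable (C := C)) J
  let k : R.obj t.pt ⟶ limit (F ⋙ R) := limit.lift _ (R.mapCone t)
  have hk : IsBidense ((adj.unit.app t.pt).hom ≫ (smallYoneda C).map k).hom := by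
    refine isBidense_of_isLimit adj hadj F
      (isLimitOfPreserves (HasBidenseReflection C).ι ht) (limit.isLimit (F ⋙ R)) _ fun j => ?_
    have h₁ := congrArg InducedCategory.Hom.hom (adj.unit.naturality (t.π.app j))
    refine (Category.assoc _ _ _).trans (Eq.trans ?_ h₁.symm)
    exact congrArg (fun x => (adj.unit.app t.pt).hom ≫ x) (((smallYoneda C).map_comp k _).symm.trans
      (congrArg (smallYoneda C).map (limit.lift_π (R.mapCone t) j)))
  have hk' : IsBidense ((smallYoneda C).map k).hom := (hadj t.pt).of_comp hk
  have : IsIso k := hk'.isFinalMor.isIso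
  have : IsIso ((limit.isLimit (F ⋙ R)).lift (R.mapCone t)) := this
  exact ⟨IsLimit.ofPointIso (limit.isLimit (F ⋙ R))⟩

theorem hasBidenseReflection_of_isLimit [HasFiniteLimits C] {J : Type} [SmallCategory J]
    [FinCategory J] (F : J ⥤ SmallPsh C) (hF : ∀ j, HasBidenseReflection C (F.obj j)) {t : Cone F}
    (ht : IsLimit t) : HasBidenseReflection C t.pt := by
  let F' := ObjectProperty.lift _ F hF
  let s : Cone ((F' ⋙ R) ⋙ smallYoneda C) :=
    { pt := t.pt
      π := t.π ≫ Functor.whiskerRight (Functor.whiskerLeft F' adj.unit) (HasBidenseReflection C).ι }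
  have hl := isLimitOfPreserves (smallYoneda C) (limit.isLimit (F' ⋙ R))
  exact ⟨_, hl.lift s, isBidense_of_isLimit adj hadj F' (t := t) ht (limit.isLimit (F' ⋙ R)) _
    fun j => hl.fac s j⟩

variable [HasFiniteLimits C] {Φ : LexWeightClass.{v}} (hC : IsLexCocomplete Φ C)
  (hΦ : LexColimitsPostulated Φ C)

include hC hΦ

/-- If the values of `D` have bidense reflections `c k`, then `φ ⋆ D` maps to `Lan_{cᵒᵖ} φ` by a
bidense morphism, being a weighted colimit of such; and `Lan_{cᵒᵖ} φ ⟶ Y (φ ⋆ c)` is bidense by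
assumption, since `c` is lex. -/
theorem hasBidenseReflection_of_lexColimit {K : Type v} [SmallCategory K] [HasFiniteLimits K]
    {φ : Kᵒᵖ ⥤ Type v} (hφ : φ ∈ Φ K) (D : K ⥤ SmallPsh C) [PreservesFiniteLimits D]
    (hD : ∀ k, HasBidenseReflection C (D.obj k)) {ψ : SmallPsh C} {γ : WeightedCocone φ D ψ}
    (hγ : γ.IsColimit) : HasBidenseReflection C ψ := by
  let D' := ObjectProperty.lift _ D hD
  have hD' : PreservesFiniteLimits D' := by
    have : PreservesFiniteLimits (D' ⋙ (HasBidenseReflection C).ι) := ‹PreservesFiniteLimits D›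
    exact preservesFiniteLimits_of_reflects_of_preserves D' (HasBidenseReflection C).ι
  have hR := reflector_preservesFiniteLimits adj hadj
  let c : K ⥤ C := D' ⋙ R
  have hc : PreservesFiniteLimits c := inferInstance
  obtain ⟨c₀, γ₀, hγ₀⟩ := hC K φ hφ c
  have hlan := Functor.isPointwiseLeftKanExtensionLeftKanExtensionUnit c.op φ
  let ψ' : SmallPsh C :=
    ⟨c.op.leftKanExtension φ, (coconeOfLan_isPointwise hlan).isSmallPresheaf fun k =>
      isSmallPresheaf_yoneda (c.obj k)⟩
  let α : φ ⟶ c.op ⋙ ψ'.obj := c.op.leftKanExtensionUnit φ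
  let γ' : WeightedCocone φ (c ⋙ smallYoneda C) ψ' := smallCoconeOfLan α
  have hγ'p : (γ'.map IsSmallPresheaf.ι).IsPointwise := smallCoconeOfLan_isPointwise hlan
  have hγ' : γ'.IsColimit := WeightedCocone.isColimit_of_isPointwise hγ'p
  -- The comparison `Lan_{cᵒᵖ} φ ⟶ Y (φ ⋆ c)` is a lex-colimit morphism, hence bidense.
  obtain ⟨f, hf, -⟩ := hγ' (γ₀.map (smallYoneda C))
  have hfin : IsFinalMor f := by
    intro Z g
    choose a ha using fun k x => (smallYoneda C).map_surjective (γ'.app k x ≫ g)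
    let θ : WeightedCocone φ c Z :=
      { app := a
        naturality := fun k k' i x => (smallYoneda C).map_injective (by
          rw [Functor.map_comp, ha, ha, γ'.naturality, Category.assoc]
          rfl) }
    obtain ⟨h, hh, hu⟩ := hγ₀ θ
    have key (h' : c₀ ⟶ Z) : f ≫ (smallYoneda C).map h' = g ↔
        ∀ k x, γ₀.app k x ≫ h' = θ.app k x := by
      constructor
      · intro e k x
        apply (smallYoneda C).map_injective
        rw [Functor.map_comp, ha, ← e, ← Category.assoc, hf]
        rfl
      · intro e
        refine hγ'.hom_ext fun k x => ?_
        rw [← Category.assoc, hf, ← ha]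
        exact ((smallYoneda C).map_comp _ _).symm.trans (congrArg _ (e k x))
    refine ⟨(smallYoneda C).map h, (key h).2 hh, fun h' hh' => ?_⟩
    obtain ⟨h', rfl⟩ := (smallYoneda C).map_surjective h'
    rw [hu h' ((key h').1 hh')]
  have hfb : IsBidense f.hom := isPostulated_iff_isBidense.1
    (hΦ f ⟨K, _, _, φ, c, α, γ₀, hφ, hc, ⟨hlan⟩, hγ₀, hfin⟩)
  let a : D ⟶ c ⋙ smallYoneda C :=
    Functor.whiskerRight (Functor.whiskerLeft D' adj.unit) (HasBidenseReflection C).ι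
  obtain ⟨m, hm, -⟩ := hγ (γ'.precomp a)
  have hmb : IsBidense m.hom := IsBidense.of_isPointwise
    (Functor.whiskerRight a IsSmallPresheaf.ι) (fun k => hadj (D'.obj k)) hγ.isPointwise hγ'p m.hom
    fun k p => congrArg InducedCategory.Hom.hom (hm k p)
  exact ⟨c₀, m ≫ f, hmb.comp hfb⟩

theorem lexClosure_le_hasBidenseReflection : LexClosure Φ ≤ HasBidenseReflection C := by
  intro ψ hψ
  induction hψ with
  | representable X => exact hasBidenseReflection_representable X
  | finiteLimit J F hF t ht ih => exact hasBidenseReflection_of_isLimit adj hadj F ih ht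
  | lexColimit K φ hφ D hD ψ γ hγ ih =>
    exact hasBidenseReflection_of_lexColimit adj hadj hC hΦ hφ D ih hγ

end

/-- The reflector of `Φₗ C` is the restriction of the bidense reflector. -/
theorem exists_lexReflector [HasFiniteLimits C] {Φ : LexWeightClass.{v}} (hC : IsLexCocomplete Φ C)
    (hΦ : LexColimitsPostulated Φ C) : ∃ L : LexCompletion Φ C ⥤ C,
      Nonempty (L ⊣ lexCompletionUnit Φ C) ∧ PreservesFiniteLimits L := by
  obtain ⟨R, adj, hadj⟩ := exists_bidenseReflector C
  have hle := lexClosure_le_hasBidenseReflection adj hadj hC hΦ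
  have hR := reflector_preservesFiniteLimits adj hadj
  let I : LexCompletion Φ C ⥤ _ := ObjectProperty.ιOfLE hle
  have hI : PreservesFiniteLimits I := ⟨fun J _ _ => by
    have : PreservesLimitsOfShape J (I ⋙ (HasBidenseReflection C).ι) :=
      preservesLimitsOfShape_ι (Q := LexClosure Φ) .representable J
    exact preservesLimitsOfShape_of_reflects_of_preserves I (HasBidenseReflection C).ι⟩
  refine ⟨I ⋙ R, ⟨?_⟩, inferInstance⟩
  exact adj.restrictFullyFaithful (ObjectProperty.fullyFaithfulιOfLE hle)
    (Functor.FullyFaithful.id C) (Iso.refl _) (Iso.refl _)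

end

/-! ### Left Kan extension of presheaves along a lex functor -/

section

variable {C : Type u} [Category.{v} C] {K : Type v} [SmallCategory K]

/-- Evaluating the left Kan extension at an object computes a colimit over a comma category. -/
noncomputable def lanEvaluationIso (F : Kᵒᵖ ⥤ Cᵒᵖ) (X : Cᵒᵖ) :
    F.lan ⋙ (evaluation Cᵒᵖ (Type v)).obj X ≅
      (Functor.whiskeringLeft _ _ (Type v)).obj (CostructuredArrow.proj F X) ⋙ colim :=
  let e (G : Kᵒᵖ ⥤ Type v) :
      (F.lan.obj G).obj X ≅ colimit (CostructuredArrow.proj F X ⋙ G) :=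
    IsColimit.coconePointUniqueUpToIso
      (Functor.isPointwiseLeftKanExtensionLeftKanExtensionUnit F G X) (colimit.isColimit _)
  have he (G : Kᵒᵖ ⥤ Type v) (T : CostructuredArrow F X) :
      (F.lanUnit.app G).app T.left ≫ (F.lan.obj G).map T.hom ≫ (e G).hom =
        colimit.ι (CostructuredArrow.proj F X ⋙ G) T :=
    (Category.assoc _ _ _).symm.trans (IsColimit.comp_coconePointUniqueUpToIso_hom
      (Functor.isPointwiseLeftKanExtensionLeftKanExtensionUnit F G X) (colimit.isColimit _) T)
  NatIso.ofComponents e fun {G₁ G₂} φ => by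
    refine (Functor.isPointwiseLeftKanExtensionLeftKanExtensionUnit F G₁ X).hom_ext fun T => ?_
    have h : φ.app T.left ≫ (F.lanUnit.app G₂).app T.left =
        (F.lanUnit.app G₁).app T.left ≫ (F.lan.map φ).app (F.obj T.left) :=
      congr_app (F.lanUnit.naturality φ) T.left
    have h₁ : ((F.lanUnit.app G₁).app T.left ≫ (F.lan.obj G₁).map T.hom) ≫
        (F.lan.map φ).app X ≫ (e G₂).hom =
          φ.app T.left ≫ colimit.ι (CostructuredArrow.proj F X ⋙ G₂) T := by
      rw [Category.assoc, NatTrans.naturality_assoc, ← reassoc_of% h, he]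
    have h₂ : ((F.lanUnit.app G₁).app T.left ≫ (F.lan.obj G₁).map T.hom) ≫
        (e G₁).hom ≫ colimMap (Functor.whiskerLeft (CostructuredArrow.proj F X) φ) =
          φ.app T.left ≫ colimit.ι (CostructuredArrow.proj F X ⋙ G₂) T := by
      rw [Category.assoc, ← Category.assoc ((F.lan.obj G₁).map T.hom), ← Category.assoc, he]
      exact ι_colimMap (Functor.whiskerLeft (CostructuredArrow.proj F X) φ) T
    exact h₁.trans h₂.symm

variable [HasFiniteLimits K]

/-- For lex `D` the comma categories that compute the left Kan extension are filtered. -/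
theorem lan_preservesFiniteLimits (D : K ⥤ C) [PreservesFiniteLimits D] :
    PreservesFiniteLimits (D.op.lan : (Kᵒᵖ ⥤ Type v) ⥤ Cᵒᵖ ⥤ Type v) := by
  have := flat_of_preservesFiniteLimits D
  apply preservesFiniteLimits_of_preservesFiniteLimitsOfSize.{v}
  intro J _ _
  apply preservesLimitsOfShape_of_evaluation (D.op.lan : (Kᵒᵖ ⥤ Type v) ⥤ Cᵒᵖ ⥤ Type v) J
  intro X
  have : IsFiltered (CostructuredArrow D.op X) :=
    IsFiltered.of_equivalence (structuredArrowOpEquivalence D (unop X))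
  exact preservesLimitsOfShape_of_natIso (lanEvaluationIso _ _).symm

/-- On a small category the smallness condition holds relative to all objects. -/
theorem isSmallPresheaf_of_smallCategory (φ : Kᵒᵖ ⥤ Type v) : IsSmallPresheaf φ := by
  have : ObjectProperty.Small.{v} (⊤ : ObjectProperty K) :=
    small_of_injective (f := Subtype.val) Subtype.val_injective
  refine SmallOn.isSmallPresheaf (P := ⊤) ⟨inferInstance, trivial, fun _ _ _ _ _ _ _ _ => trivial⟩
    ⟨fun X x => ⟨X, trivial, 𝟙 X, x, φ.map_id_apply _ x⟩, fun X A A' _ _ f f' y y' h =>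
      ⟨X, trivial, 𝟙 X, f, f', Category.id_comp f, Category.id_comp f', h⟩⟩

variable [HasFiniteLimits C]

/-- Left Kan extension of small presheaves along `D`. -/
noncomputable def smallLan (D : K ⥤ C) : SmallPsh K ⥤ SmallPsh C :=
  ObjectProperty.lift _ (IsSmallPresheaf.ι ⋙ D.op.lan) fun φ =>
    (coconeOfLan_isPointwise (Functor.isPointwiseLeftKanExtensionLeftKanExtensionUnit D.op
      φ.obj)).isSmallPresheaf fun k => isSmallPresheaf_yoneda (D.obj k)

/-- Restriction of small presheaves along `D`. -/
def smallRestriction (D : K ⥤ C) : SmallPsh C ⥤ SmallPsh K :=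
  ObjectProperty.lift _ (IsSmallPresheaf.ι ⋙ (Functor.whiskeringLeft _ _ _).obj D.op) fun _ =>
    isSmallPresheaf_of_smallCategory _

/-- Left Kan extension along `D` is left adjoint to restriction along `D`, for small presheaves. -/
noncomputable def smallLanAdjunction (D : K ⥤ C) : smallLan D ⊣ smallRestriction D :=
  (D.op.lanAdjunction (Type v)).restrictFullyFaithful (ObjectProperty.fullyFaithfulι _)
    (ObjectProperty.fullyFaithfulι _) (Iso.refl _) (Iso.refl _)

theorem smallLan_preservesFiniteLimits (D : K ⥤ C) [PreservesFiniteLimits D] :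
    PreservesFiniteLimits (smallLan D) := by
  have := lan_preservesFiniteLimits D
  have : PreservesFiniteLimits (IsSmallPresheaf (C := K)).ι := ⟨fun J _ _ => inferInstance⟩
  have : PreservesFiniteLimits (smallLan D ⋙ IsSmallPresheaf.ι) :=
    inferInstanceAs (PreservesFiniteLimits (IsSmallPresheaf.ι ⋙ D.op.lan))
  exact preservesFiniteLimits_of_reflects_of_preserves (smallLan D) IsSmallPresheaf.ι

end

/-- Left adjoints preserve weighted colimits. -/
theorem WeightedCocone.IsColimit.map_of_adjunction {K : Type v} [SmallCategory K] {A : Type u₁}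
    [Category.{v₁} A] {B : Type*} [Category* B] {F : A ⥤ B} {G : B ⥤ A} (adj : F ⊣ G)
    {φ : Kᵒᵖ ⥤ Type v} {D : K ⥤ A} {c : A} {γ : WeightedCocone φ D c} (hγ : γ.IsColimit) :
    (γ.map F).IsColimit := by
  intro X θ
  let θ' : WeightedCocone φ D (G.obj X) :=
    { app := fun k x => adj.homEquiv _ _ (θ.app k x)
      naturality := fun k k' g x => by
        rw [θ.naturality, ← adj.homEquiv_naturality_left]
        rfl }
  obtain ⟨h, hh, hu⟩ := hγ θ'
  have key (h' : F.obj c ⟶ X) (k : K) (x : φ.obj (op k)) :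
      (γ.map F).app k x ≫ h' = θ.app k x ↔ γ.app k x ≫ adj.homEquiv _ _ h' = θ'.app k x := by
    rw [← adj.homEquiv_naturality_left]
    exact (adj.homEquiv _ _).injective.eq_iff.symm
  refine ⟨(adj.homEquiv _ _).symm h, fun k x => (key _ k x).2 ?_, fun h' hh' => ?_⟩
  · rw [Equiv.apply_symm_apply, hh]
  · rw [Equiv.eq_symm_apply]
    exact hu _ fun k x => (key _ k x).1 (hh' k x)

/-! ### Colimits weighted by the saturation -/

section

variable {C : Type u} [Category.{v} C] [HasFiniteLimits C] {K : Type v} [SmallCategory K]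
  [HasFiniteLimits K] {Φ : LexWeightClass.{v}}

/-- Left Kan extension along `D` extends `D` along the Yoneda embeddings. -/
noncomputable def smallLanYonedaIso (D : K ⥤ C) (k : K) :
    (smallLan D).obj ((smallYoneda K).obj k) ≅ (smallYoneda C).obj (D.obj k) :=
  let E (χ : SmallPsh C) : ((smallLan D).obj ((smallYoneda K).obj k) ⟶ χ) ≃
      ((smallYoneda C).obj (D.obj k) ⟶ χ) :=
    (((smallLanAdjunction D).homEquiv _ χ).trans smallYonedaEquiv).trans
      (smallYonedaEquiv (C := C)).symm
  Iso.symm <| Coyoneda.ext _ _ (fun {χ} => (E χ).symm) (fun {χ} => E χ)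
    (fun f => (E _).apply_symm_apply f) (fun f => (E _).symm_apply_apply f) fun f g => by
      refine Eq.trans ?_ (smallYonedaEquiv_symm_comp _ g).symm
      refine congrArg (smallYonedaEquiv (C := C)).symm ?_
      exact congrArg (smallYonedaEquiv (C := K))
        ((smallLanAdjunction D).homEquiv_naturality_right f g)

/-- Left Kan extension along a lex functor maps `Φₗ K` into `Φₗ C`. -/
theorem lexClosure_smallLan (D : K ⥤ C) [PreservesFiniteLimits D] {φ : SmallPsh K}
    (hφ : LexClosure Φ φ) : LexClosure Φ ((smallLan D).obj φ) := by
  have := smallLan_preservesFiniteLimits D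
  induction hφ with
  | representable k => exact .of_iso (smallLanYonedaIso D k) (.representable _)
  | finiteLimit J F hF t ht ih =>
    exact .finiteLimit J (F ⋙ smallLan D) ih ((smallLan D).mapCone t) (isLimitOfPreserves _ ht)
  | lexColimit K' φ' hφ' D' hD' ψ γ hγ ih =>
    exact .lexColimit K' φ' hφ' (D' ⋙ smallLan D) ih _ (γ.map (smallLan D))
      (hγ.map_of_adjunction (smallLanAdjunction D))

/-- For `φ` in `Φₗ K` and lex `D`, the presheaf `Lan_{Dᵒᵖ} φ` lies in `Φₗ C`; an object of `C`
whose representable is its bidense reflection is the weighted colimit `φ ⋆ D`. -/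
theorem isLexCocomplete_saturation (hC : IsLexCocomplete Φ C) (hΦ : LexColimitsPostulated Φ C) :
    IsLexCocomplete (saturation Φ) C := by
  rintro K _ _ φ ⟨hs, hφ⟩ D _
  obtain ⟨R, adj, hadj⟩ := exists_bidenseReflector C
  obtain ⟨c, f, hf⟩ := lexClosure_le_hasBidenseReflection adj hadj hC hΦ _
    (lexClosure_smallLan D hφ)
  have hlan := Functor.isPointwiseLeftKanExtensionLeftKanExtensionUnit D.op φ
  let ψ : SmallPsh C := (smallLan D).obj ⟨φ, hs⟩
  let γ' : WeightedCocone φ (D ⋙ smallYoneda C) ψ :=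
    smallCoconeOfLan (D.op.leftKanExtensionUnit φ)
  have hγ' : γ'.IsColimit :=
    WeightedCocone.isColimit_of_isPointwise (smallCoconeOfLan_isPointwise hlan)
  choose a ha using fun k x => (smallYoneda C).map_surjective (γ'.app k x ≫ f)
  let γ : WeightedCocone φ D c :=
    { app := a
      naturality := fun k k' i x => (smallYoneda C).map_injective (by
        rw [Functor.map_comp, ha, ha, γ'.naturality, Category.assoc]
        rfl) }
  refine ⟨c, γ, fun Z θ => ?_⟩
  obtain ⟨g, hg, -⟩ := hγ' (θ.map (smallYoneda C))
  have key (h : c ⟶ Z) : (∀ k x, γ.app k x ≫ h = θ.app k x) ↔ f ≫ (smallYoneda C).map h = g := by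
    constructor
    · intro e
      refine hγ'.hom_ext fun k x => ?_
      rw [← Category.assoc, hg, ← ha]
      exact ((smallYoneda C).map_comp _ _).symm.trans (congrArg _ (e k x))
    · intro e k x
      apply (smallYoneda C).map_injective
      rw [Functor.map_comp, ha, Category.assoc, e, hg]
      rfl
  obtain ⟨h, hh, hu⟩ := hf.isFinalMor Z g
  obtain ⟨h, rfl⟩ := (smallYoneda C).map_surjective h
  exact ⟨h, (key h).2 hh, fun h' hh' => (smallYoneda C).map_injective (hu _ ((key h').1 hh'))⟩

end

end LexExact

theorem mainTheorem3 {C : Type u} [Category.{v} C] [HasFiniteLimits C]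
    (Φ : LexExact.LexWeightClass.{v}) (hC : LexExact.IsLexCocomplete Φ C) :
    LexExact.IsExact Φ C ↔ LexExact.LexColimitsPostulated Φ C :=
  ⟨LexExact.lexColimitsPostulated_of_isExact, fun hΦ =>
    ⟨LexExact.isLexCocomplete_saturation hC hΦ, LexExact.exists_lexReflector hC hΦ⟩⟩
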